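/- **Conventions.** A ranked alphabet is a finite set of symbols, each with a fixed rank in $\mathbb N$. $T_\Sigma(X)$ is the set of terms over the ranked alphabet $\Sigma$ and the variables $X=\{x_1,x_2,\dots\}$, and $T_\Sigma$ the set of ground (variable-free) terms. $POS(t)$ is the set of positions of $t$, $\lambda$ is the root position, $t/\alpha$ is the subterm of $t$ at $\alpha$, $var(t)$ is the set of variables of $t$, and $sub(t)$, $sub(L)$ are the sets of subterms of $t$ and of the elements of $L$. A term is linear if no variable occurs in it more than once; $u$ is a supertree of $v$ if $u$ is linear and $v=\sigma(u)$ for some substitution $\sigma$. A term rewrite system (TRS) $R$ is a finite set of rules $l\to r$ between terms with $var(r)\subseteq var(l)$; $sign(R)$ is the set of symbols occurring in its rules; $R$ is left-linear if every left-hand side is linear; $\to_R^*$ is the reflexive transitive closure of one-step rewriting, and $R^*(L)=\{p\mid q\to_R^* p\text{ for some }q\in L\}$. Call $(l_2,\beta,l_3,\sigma)$ an *overlap* of $R$ if there are rules $l_1\to r_1$, $l_2\to r_2$ in $R$ and a position $\alpha\in POS(r_1)$ such that $\beta\in POS(l_2)$, $\alpha=\lambda$ or $\beta=\lambda$, $l_3$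 is a supertree of $l_2/\beta$ with $var(l_3)\cap var(l_1)=\emptyset$, and $\sigma$ is a most general unifier of $r_1/\alpha$ and $l_3$. $R$ is a *generalized semi-monadic* TRS (GSM-TRS) if no left-hand side is a variable and, for every overlap $(l_2,\beta,l_3,\sigma)$, either $l_2/\beta$ is a variable, or for each $\gamma\in POS(l_3)$ such that $l_2/\beta\gamma$ is a variable, $\sigma(l_3/\gamma)$ is a variable or a ground term. A bottom-up tree automaton (bta) over $\Sigma$ consists of a finite set of states (new symbols of rank $0$), a subset of final states, and a finite set of rules of the forms $\delta(a_1,\dots,a_n)\to a$ with $\delta\in\Sigma$ of rank $n$, and $a\to a'$, where $a_1,\dots,a_n,a,a'$ are states. Its rules form a ground TRS, and it recognizes the set of all $t\in T_\Sigma$ that reduce to a final state. $R$ is an *EPRF-TRS* (it effectively preserves recognizability of finite tree languages) if there is an algorithm that, given a ranked alphabet $\Sigma\supseteq sign(R)$ and a finite $L\subseteq T_\Sigma$, computes a bta over $\Sigma$ that recognizes $R^*(L)$. **Theorem.** Let $R$ be a left-linear GSM-TRS. Then $R$ is an EPRF-TRS. Moreover, an automaton for $R^*(L)$ is given by the following construction.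 Let $E$ be the set of all ground terms of the form $\sigma(l_3/\gamma)$, where $(l_2,\beta,l_3,\sigma)$ is an overlap of $R$, $l_3$ is not a variable, $\gamma\in POS(l_3)$ and $l_2/\beta\gamma$ is a variable. Let $\Sigma\supseteq sign(R)$ be a ranked alphabet and $L\subseteq T_\Sigma$ finite. Let $D$ be the union of $sub(L)$ and the set of all $e(p)$, where $p$ is a subterm of the right-hand side of a rule of $R$ and $e$ is a substitution with $e(x)\in sub(L\cup E)$ for all $x\in var(p)$. For $i\ge 0$ let $\mathcal C_i$ have the states $\langle p\rangle$, $p\in sub(D)$, the final states $\langle p\rangle$, $p\in L$, and the rule set $S_i$, where - $S_0$ consists of all rules $\delta(\langle p_1\rangle,\dots,\langle p_m\rangle)\to\langle\delta(p_1,\dots,p_m)\rangle$ with $\delta\in\Sigma$ of rank $m$ and $p_1,\dots,p_m,\delta(p_1,\dots,p_m)\in sub(D)$ (the rules of the fundamental automaton of $D$); - $S_{i+1}$ consists of $S_i$ and of all rules $\langle e(r)\rangle\to c$ such that $l\to r$ is a rule of $R$, $e$ is a substitution with $e(x)\in sub(L\cup E)$ for all $x\in var(l)$, $c$ is a state, and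 the term obtained from $l$ by replacing each variable $x$ by the state $\langle e(x)\rangle$ reduces to $c$ by $S_i$. Then $E$ and $D$ are finite, there is a least $M\ge 0$ with $S_M=S_{M+1}$, and $\mathcal C_M$ is a bta over $\Sigma$ that recognizes $R^*(L)$. -/

import Mathlib

/-! ## Terms

`F` is a type of symbols and `ar : F → ℕ` gives every symbol its (unique) rank.  A ranked alphabet is
a finite set of symbols.  Variables are natural numbers. -/

/-- Well-ranked terms with variables `var 0, var 1, …`. -/
inductive Term {F : Type} (ar : F → ℕ) : Type
  | var (x : ℕ) : Term ar
  | app (f : F) (ts : Fin (ar f) → Term ar) : Term ar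

namespace Term

variable {F : Type} {ar : F → ℕ}

/-- Application of a substitution. -/
def subst (σ : ℕ → Term ar) : Term ar → Term ar
  | var x => σ x
  | app f ts => app f (fun i => subst σ (ts i))

/-- The subterm `t/α` at the position `α`; it is `none` if `α` is not a position of `t`.
The arguments of a symbol are numbered from `0`. -/
def subAt : Term ar → List ℕ → Option (Term ar)
  | var x, [] => some (var x)
  | var _, _ :: _ => none
  | app f ts, [] => some (app f ts)
  | app f ts, i :: α => if h : i < ar f then subAt (ts ⟨i, h⟩) α else none

/-- The set of subterms. -/
def sub (t : Term ar) : Set (Term ar) := {s | ∃ α, t.subAt α = some s}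

/-- The set of variables occurring in a term. -/
def vars (t : Term ar) : Set ℕ := {x | var x ∈ t.sub}

/-- The set of symbols occurring in a term. -/
def symbols (t : Term ar) : Set F := {f | ∃ ts, app f ts ∈ t.sub}

def IsVar (t : Term ar) : Prop := ∃ x, t = var x

def IsGround (t : Term ar) : Prop := t.vars = ∅

/-- Every variable occurs at most once. -/
def Linear (t : Term ar) : Prop :=
  ∀ x α β, t.subAt α = some (var x) → t.subAt β = some (var x) → α = β

/-- `u` is a supertree of `v`: it is linear, and `v` is an instance of it. -/
def Supertree (u v : Term ar) : Prop := u.Linear ∧ ∃ σ : ℕ → Term ar, v = u.subst σ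

/-- `σ` is a most general unifier of `s` and `t`. -/
def IsMGU (σ : ℕ → Term ar) (s t : Term ar) : Prop :=
  s.subst σ = t.subst σ ∧
    ∀ θ : ℕ → Term ar, s.subst θ = t.subst θ → ∃ τ : ℕ → Term ar, ∀ x, θ x = (σ x).subst τ

/-- The word of symbols of a ground term in prefix (Polish) notation. -/
def word : Term ar → List F
  | var _ => []
  | app f ts => f :: (List.ofFn fun i => word (ts i)).flatten

end Term

/-- The set `T_Σ` of ground terms over the alphabet `Sg`. -/
def groundTerms {F : Type} (ar : F → ℕ) (Sg : Set F) : Set (Term ar) :=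
  {t | t.IsGround ∧ t.symbols ⊆ Sg}

/-- The set `sub(L)` of subterms of the elements of a tree language. -/
def subLang {F : Type} {ar : F → ℕ} (L : Set (Term ar)) : Set (Term ar) := ⋃ t ∈ L, t.sub

/-! ## Term rewrite systems -/

/-- One rewrite step: an instance of a left-hand side, at some position, is replaced by the
corresponding instance of the right-hand side. -/
inductive Step {F : Type} {ar : F → ℕ} (R : Set (Term ar × Term ar)) : Term ar → Term ar → Prop
  | root (l r : Term ar) (σ : ℕ → Term ar) (h : (l, r) ∈ R) : Step R (l.subst σ) (r.subst σ)
  | arg (f : F) (ts : Fin (ar f) → Term ar) (i : Fin (ar f)) (s : Term ar) (h : Step R (ts i) s) :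
      Step R (Term.app f ts) (Term.app f (Function.update ts i s))

/-- Reduction in any finite number of steps. -/
def Reduces {F : Type} {ar : F → ℕ} (R : Set (Term ar × Term ar)) : Term ar → Term ar → Prop :=
  Relation.ReflTransGen (Step R)

/-- A term rewrite system: finitely many rules `l → r`, each variable of `r` occurring in `l`. -/
structure TRS {F : Type} (ar : F → ℕ) where
  rules : Set (Term ar × Term ar)
  finite : rules.Finite
  vars_subset : ∀ l r, (l, r) ∈ rules → r.vars ⊆ l.vars

namespace TRS

variable {F : Type} {ar : F → ℕ}

/-- `sign(R)`: the symbols appearing in the rules. -/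
def sign (R : TRS ar) : Set F := {f | ∃ l r, (l, r) ∈ R.rules ∧ (f ∈ l.symbols ∨ f ∈ r.symbols)}

def LeftLinear (R : TRS ar) : Prop := ∀ l r, (l, r) ∈ R.rules → l.Linear

/-- `R*(L)`: the set of descendants of the trees in `L`. -/
def descendants (R : TRS ar) (L : Set (Term ar)) : Set (Term ar) :=
  {p | ∃ q ∈ L, Reduces R.rules q p}

/-- There are rules `l₁ → r₁` and `l₂ → r₂` and positions `α` of `r₁` and `β` of `l₂`, one of them
the root, such that `l₃` is a supertree of `l₂/β`, has no variable in common with `l₁`, and has the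
most general unifier `σ` with `r₁/α`. -/
def Overlap (R : TRS ar) (l₂ : Term ar) (β : List ℕ) (l₃ : Term ar) (σ : ℕ → Term ar) : Prop :=
  ∃ l₁ r₁ r₂ : Term ar, (l₁, r₁) ∈ R.rules ∧ (l₂, r₂) ∈ R.rules ∧
    ∃ (α : List ℕ) (u v : Term ar), r₁.subAt α = some u ∧ l₂.subAt β = some v ∧
      (α = [] ∨ β = []) ∧ l₃.Supertree v ∧ Disjoint l₃.vars l₁.vars ∧ Term.IsMGU σ u l₃

/-- Generalized semi-monadic term rewrite systems. -/
def IsGSM (R : TRS ar) : Prop :=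
  (∀ l r, (l, r) ∈ R.rules → ¬ l.IsVar) ∧
    ∀ l₂ β l₃ σ, R.Overlap l₂ β l₃ σ →
      (∃ x, l₂.subAt β = some (Term.var x)) ∨
        ∀ γ w, l₃.subAt γ = some w → (∃ x, l₂.subAt (β ++ γ) = some (Term.var x)) →
          (w.subst σ).IsVar ∨ (w.subst σ).IsGround

/-- The set `E` of the ground terms `σ(l₃/γ)` that arise from overlaps with `l₃` not a variable. -/
def setE (R : TRS ar) : Set (Term ar) :=
  {u | u.IsGround ∧ ∃ l₂ β l₃ σ, R.Overlap l₂ β l₃ σ ∧ ¬ l₃.IsVar ∧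
    ∃ γ w, l₃.subAt γ = some w ∧ (∃ x, l₂.subAt (β ++ γ) = some (Term.var x)) ∧ u = w.subst σ}

/-- The set `D`: the subterms of `L`, and the subterms of right-hand sides with elements of
`sub(L ∪ E)` substituted for their variables. -/
def setD (R : TRS ar) (L : Set (Term ar)) : Set (Term ar) :=
  subLang L ∪
    {t | ∃ (l r p : Term ar) (e : ℕ → Term ar), (l, r) ∈ R.rules ∧ p ∈ r.sub ∧
      (∀ x ∈ p.vars, e x ∈ subLang (L ∪ R.setE)) ∧ t = p.subst e}

end TRS

/-! ## Bottom-up tree automata -/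

/-- The ranks of the symbols of the disjoint union of `F` with a set of states of rank `0`. -/
def stateRank {F : Type} (ar : F → ℕ) (Q : Type) : F ⊕ Q → ℕ := Sum.elim ar (fun _ => 0)

/-- A state, as a term. -/
def stateTerm {F : Type} (ar : F → ℕ) {Q : Type} (q : Q) : Term (stateRank ar Q) :=
  Term.app (ar := stateRank ar Q) (Sum.inr q) Fin.elim0

/-- A term over `F`, seen as a term over `F` and the states. -/
def Term.lift {F : Type} {ar : F → ℕ} (Q : Type) : Term ar → Term (stateRank ar Q)
  | .var x => .var x
  | .app f ts => Term.app (ar := stateRank ar Q) (Sum.inl f) (fun i => Term.lift Q (ts i))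

/-- The rule `δ(a₁, …, aₙ) → a`. -/
def symbolRule {F : Type} (ar : F → ℕ) {Q : Type} (δ : F) (as : Fin (ar δ) → Q) (a : Q) :
    Term (stateRank ar Q) × Term (stateRank ar Q) :=
  (Term.app (ar := stateRank ar Q) (Sum.inl δ) (fun i => stateTerm ar (as i)), stateTerm ar a)

/-- The rule `a → a'`. -/
def lambdaRule {F : Type} (ar : F → ℕ) {Q : Type} (a a' : Q) :
    Term (stateRank ar Q) × Term (stateRank ar Q) :=
  (stateTerm ar a, stateTerm ar a')

/-- The data of a tree automaton; see `IsBTA` for the conditions on them. -/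
structure TreeAutomaton {F : Type} (ar : F → ℕ) (Q : Type) where
  states : Set Q
  rules : Set (Term (stateRank ar Q) × Term (stateRank ar Q))
  final : Set Q

namespace TreeAutomaton

variable {F : Type} {ar : F → ℕ} {Q : Type}

/-- `A` is a bottom-up tree automaton over the alphabet `Sg`. -/
def IsBTA (Sg : Set F) (A : TreeAutomaton ar Q) : Prop :=
  A.states.Finite ∧ A.rules.Finite ∧ A.final ⊆ A.states ∧
    ∀ ρ ∈ A.rules,
      (∃ δ ∈ Sg, ∃ (as : Fin (ar δ) → Q) (a : Q),
        (∀ i, as i ∈ A.states) ∧ a ∈ A.states ∧ ρ = symbolRule ar δ as a) ∨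
      (∃ a ∈ A.states, ∃ a' ∈ A.states, ρ = lambdaRule ar a a')

/-- The tree language over `Sg` recognized by `A`, whose rules act as a ground rewrite system. -/
def language (Sg : Set F) (A : TreeAutomaton ar Q) : Set (Term ar) :=
  {t | t ∈ groundTerms ar Sg ∧ ∃ a ∈ A.final, Reduces A.rules (t.lift Q) (stateTerm ar a)}

/-- The fundamental automaton of a tree language over `Sg`; its states are the subterms of the
elements of the language. -/
def fundamental (Sg : Set F) (L : Set (Term ar)) : TreeAutomaton ar (Term ar) where
  states := subLang L
  rules := {ρ | ∃ δ ∈ Sg, ∃ ps : Fin (ar δ) → Term ar,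
    (∀ i, ps i ∈ subLang L) ∧ Term.app δ ps ∈ subLang L ∧ ρ = symbolRule ar δ ps (Term.app δ ps)}
  final := L

end TreeAutomaton

namespace TRS

variable {F : Type} {ar : F → ℕ}

/-- The rule sets `S₀ ⊆ S₁ ⊆ …` of the saturation procedure. -/
def satRules (R : TRS ar) (Sg : Set F) (L : Set (Term ar)) :
    ℕ → Set (Term (stateRank ar (Term ar)) × Term (stateRank ar (Term ar)))
  | 0 => (TreeAutomaton.fundamental Sg (R.setD L)).rules
  | i + 1 => satRules R Sg L i ∪
      {ρ | ∃ (l r : Term ar) (e : ℕ → Term ar) (c : Term ar), (l, r) ∈ R.rules ∧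
        (∀ x ∈ l.vars, e x ∈ subLang (L ∪ R.setE)) ∧
        c ∈ (TreeAutomaton.fundamental Sg (R.setD L)).states ∧
        Reduces (satRules R Sg L i)
          ((l.lift (Term ar)).subst fun x => stateTerm ar (e x)) (stateTerm ar c) ∧
        ρ = lambdaRule ar (r.subst e) c}

/-- The automata `C₀, C₁, …` of the saturation procedure. -/
def satAutomaton (R : TRS ar) (Sg : Set F) (L : Set (Term ar)) (i : ℕ) :
    TreeAutomaton ar (Term ar) where
  states := (TreeAutomaton.fundamental Sg (R.setD L)).states
  rules := R.satRules Sg L i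
  final := (TreeAutomaton.fundamental Sg L).final

end TRS

/-! ## Effective preservation of recognizability -/

/-- The universe of symbols: a symbol is a pair of a name and a rank. -/
abbrev RSym : Type := ℕ × ℕ

/-- The rank of a symbol. -/
abbrev rank : RSym → ℕ := Prod.snd

/-- Codes of tree automata whose states are natural numbers: the list of states, the list of final
states, the list of the rules `δ(a₁, …, aₙ) → a`, and the list of the rules `a → a'`. -/
abbrev AutomatonCode : Type :=
  List ℕ × List ℕ × List (RSym × List ℕ × ℕ) × List (ℕ × ℕ)

/-- The tree automaton given by a code.  Entries with a wrong number of arguments are no rules. -/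
def AutomatonCode.toAutomaton (c : AutomatonCode) : TreeAutomaton rank ℕ where
  states := {q | q ∈ c.1}
  rules := {ρ | (∃ (δ : RSym) (as : Fin (rank δ) → ℕ) (a : ℕ),
      (δ, List.ofFn as, a) ∈ c.2.2.1 ∧ ρ = symbolRule rank δ as a) ∨
    (∃ a a' : ℕ, (a, a') ∈ c.2.2.2 ∧ ρ = lambdaRule rank a a')}
  final := {q | q ∈ c.2.1}

/-- `R` effectively preserves recognizability of finite tree languages: an algorithm, given any
ranked alphabet `Sg` that contains `sign(R)` and any finite tree language `L` over `Sg` (as lists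
of symbols and of terms), computes a bottom-up tree automaton over `Sg` that recognizes `R*(L)`. -/
def TRS.IsEPRF (R : TRS rank) : Prop :=
  ∃ f : List RSym × List (List RSym) → AutomatonCode, Computable f ∧
    ∀ (Sg : List RSym) (L : List (Term rank)),
      R.sign ⊆ {δ | δ ∈ Sg} → (∀ t ∈ L, t ∈ groundTerms rank {δ | δ ∈ Sg}) →
        (f (Sg, L.map Term.word)).toAutomaton.IsBTA {δ | δ ∈ Sg} ∧
        (f (Sg, L.map Term.word)).toAutomaton.language {δ | δ ∈ Sg} =
          R.descendants {t | t ∈ L}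

/-! ## Subterms, variables and substitutions -/

namespace Term

variable {F : Type} {ar : F → ℕ}

/-! Read a state `⟨p⟩` as standing for the descendants of `p`. A symbol rule leads from `p₁, …, pₘ`
to `δ(p₁, …, pₘ)`, and a rule `a → b` between states is added only if `b` reduces to `a`; hence a
run of `t` to `p` gives a reduction of `p` to `t` (`reduces_of_run`). Conversely, each `p ∈ L`
evaluates to itself, so it is enough that runs survive rewriting (`run_of_step`): if `lθ` evaluates
to `q`, so does `rθ`. By left-linearity a run on `lθ` selects one state `s x` at each variable `x`
of `l`. If all of these lie in `A = sub(L ∪ E)`, saturation provides state changes from `r.subst s`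
to `q`, while symbol rules evaluate `rθ` to `r.subst s`.

That the `s x` lie in `A` is the core, and the place where the GSM condition is used
(`exists_values`). From the variable `x`, follow the run upwards to the first nontrivial state
change at a symbol, or to the root of `l`. Up to there the symbol rules only build terms, so `s x`
is still visible in the state, at the position of `x`. That state is an element of `A`, or an
instance `u.subst e` of a subterm `u` of a right-hand side with values of `e` in `A`. At an inner
state change `u` is a whole right-hand side, and otherwise the overlap is at the root of `l`; this
is the alternative `α = λ` or `β = λ`. The part of `l` just read, cut off where deeper state changes
have happened and with distinct fresh variables, is a supertree unifiable with `u`. By the GSM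
condition the most general unifier sends the variable at the position of `x` to a ground term, which
belongs to `E`, or to a variable, and then `s x` is a subterm of a value of `e`
(`overlap_value_mem`).

The set `E` is finite because an element depends only on the rules, the positions and the shape of
`l₃` (`overlap_value_unique`). For effectiveness, `R` is fixed, so `E` is hard-wired into a
primitive recursive fixed-point computation on prefix words. Its automaton differs slightly from
`C_M`; the argument above is therefore carried out once, for `IsSaturated`, and applied to both. -/

@[simp] theorem subAt_nil (t : Term ar) : t.subAt [] = some t := by
  cases t <;> rfl

@[simp] theorem subAt_var_cons (x i : ℕ) (α : List ℕ) :
    (var x : Term ar).subAt (i :: α) = none := rfl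

theorem subAt_app_cons (f : F) (ts : Fin (ar f) → Term ar) (i : ℕ) (α : List ℕ) :
    (app f ts).subAt (i :: α) = if h : i < ar f then (ts ⟨i, h⟩).subAt α else none := rfl

@[simp] theorem subAt_app_fin (f : F) (ts : Fin (ar f) → Term ar) (i : Fin (ar f)) (α : List ℕ) :
    (app f ts).subAt (i :: α) = (ts i).subAt α := by
  simp [subAt_app_cons]

theorem subAt_app_cons_eq_some {f : F} {ts : Fin (ar f) → Term ar} {i : ℕ} {α : List ℕ}
    {s : Term ar} (h : (app f ts).subAt (i :: α) = some s) :
    ∃ j : Fin (ar f), i = j ∧ (ts j).subAt α = some s := by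
  rw [subAt_app_cons] at h
  split at h
  · exact ⟨⟨i, ‹_›⟩, rfl, h⟩
  · cases h

theorem subAt_append {t u : Term ar} {α : List ℕ} (h : t.subAt α = some u) (β : List ℕ) :
    t.subAt (α ++ β) = u.subAt β := by
  induction α generalizing t with
  | nil => simp at h; simp [h]
  | cons i α ih =>
    cases t with
    | var x => simp at h
    | app f ts =>
      obtain ⟨j, rfl, hj⟩ := subAt_app_cons_eq_some h
      simpa using ih hj

theorem self_mem_sub (t : Term ar) : t ∈ t.sub := ⟨[], by simp⟩

theorem sub_trans {s t u : Term ar} (h : s ∈ t.sub) (h' : t ∈ u.sub) : s ∈ u.sub := by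
  obtain ⟨α, hα⟩ := h
  obtain ⟨β, hβ⟩ := h'
  exact ⟨β ++ α, by rw [subAt_append hβ, hα]⟩

theorem arg_mem_sub (f : F) (ts : Fin (ar f) → Term ar) (i : Fin (ar f)) :
    ts i ∈ (app f ts).sub := ⟨[(i : ℕ)], by simp⟩

theorem mem_sub_var {x : ℕ} {s : Term ar} : s ∈ (var x : Term ar).sub ↔ s = var x := by
  constructor
  · rintro ⟨α, hα⟩
    cases α <;> simp_all
  · rintro rfl
    exact self_mem_sub _

theorem mem_sub_app {f : F} {ts : Fin (ar f) → Term ar} {s : Term ar} :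
    s ∈ (app f ts).sub ↔ s = app f ts ∨ ∃ i, s ∈ (ts i).sub := by
  constructor
  · rintro ⟨α, hα⟩
    cases α with
    | nil => simp at hα; exact Or.inl hα.symm
    | cons i α =>
      obtain ⟨j, -, hj⟩ := subAt_app_cons_eq_some hα
      exact Or.inr ⟨j, α, hj⟩
  · rintro (rfl | ⟨i, hi⟩)
    · exact self_mem_sub _
    · exact sub_trans hi (arg_mem_sub f ts i)

@[simp] theorem mem_vars_var {x y : ℕ} : x ∈ (var y : Term ar).vars ↔ x = y := by
  simp [vars, mem_sub_var]

@[simp] theorem mem_vars_app {f : F} {ts : Fin (ar f) → Term ar} {x : ℕ} :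
    x ∈ (app f ts).vars ↔ ∃ i, x ∈ (ts i).vars := by
  simp [vars, mem_sub_app]

theorem vars_subset_of_mem_sub {s t : Term ar} (h : s ∈ t.sub) : s.vars ⊆ t.vars :=
  fun _ hx => sub_trans hx h

theorem symbols_subset_of_mem_sub {s t : Term ar} (h : s ∈ t.sub) : s.symbols ⊆ t.symbols :=
  fun _ ⟨ts, hts⟩ => ⟨ts, sub_trans hts h⟩

theorem mem_symbols_app {f g : F} {ts : Fin (ar f) → Term ar} :
    g ∈ (app f ts).symbols ↔ g = f ∨ ∃ i, g ∈ (ts i).symbols := by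
  constructor
  · rintro ⟨us, hus⟩
    rcases mem_sub_app.1 hus with h | ⟨i, hi⟩
    · cases h
      exact Or.inl rfl
    · exact Or.inr ⟨i, us, hi⟩
  · rintro (rfl | ⟨i, us, hus⟩)
    · exact ⟨ts, self_mem_sub _⟩
    · exact ⟨us, mem_sub_app.2 (Or.inr ⟨i, hus⟩)⟩

theorem isGround_app {f : F} {ts : Fin (ar f) → Term ar} :
    (app f ts).IsGround ↔ ∀ i, (ts i).IsGround := by
  simp only [IsGround, Set.eq_empty_iff_forall_notMem, mem_vars_app, not_exists]
  exact forall_comm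

theorem not_isGround_var (x : ℕ) : ¬ (var x : Term ar).IsGround := fun h => by
  have : x ∈ (var x : Term ar).vars := by simp
  rw [h] at this
  exact this

theorem IsGround.of_mem_sub {s t : Term ar} (ht : t.IsGround) (h : s ∈ t.sub) : s.IsGround :=
  Set.subset_eq_empty (vars_subset_of_mem_sub h) ht

@[simp] theorem subst_var (σ : ℕ → Term ar) (x : ℕ) : (var x).subst σ = σ x := rfl

@[simp] theorem subst_app (σ : ℕ → Term ar) (f : F) (ts : Fin (ar f) → Term ar) :
    (app f ts).subst σ = app f fun i => (ts i).subst σ := rfl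

theorem subst_congr {t : Term ar} {σ τ : ℕ → Term ar} (h : ∀ x ∈ t.vars, σ x = τ x) :
    t.subst σ = t.subst τ := by
  induction t with
  | var x => exact h x (by simp)
  | app f ts ih =>
    simp only [subst_app, app.injEq, heq_eq_eq, true_and]
    exact funext fun i => ih i fun x hx => h x (mem_vars_app.2 ⟨i, hx⟩)

theorem subst_var_eq (t : Term ar) : t.subst var = t := by
  induction t with
  | var x => rfl
  | app f ts ih => simp [ih]

theorem IsGround.subst_eq {t : Term ar} (h : t.IsGround) (σ : ℕ → Term ar) : t.subst σ = t := by
  conv_rhs => rw [← subst_var_eq t]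
  exact subst_congr fun x hx => by rw [h] at hx; exact hx.elim

theorem subAt_subst {t s : Term ar} {α : List ℕ} (h : t.subAt α = some s) (σ : ℕ → Term ar) :
    (t.subst σ).subAt α = some (s.subst σ) := by
  induction α generalizing t with
  | nil => simp_all
  | cons i α ih =>
    cases t with
    | var x => simp at h
    | app f ts =>
      obtain ⟨j, rfl, hj⟩ := subAt_app_cons_eq_some h
      simpa using ih hj

theorem subst_mem_sub_subst {s t : Term ar} (h : s ∈ t.sub) (σ : ℕ → Term ar) :
    s.subst σ ∈ (t.subst σ).sub :=
  let ⟨α, hα⟩ := h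
  ⟨α, subAt_subst hα σ⟩

theorem mem_sub_subst {s t : Term ar} {σ : ℕ → Term ar} (h : s ∈ (t.subst σ).sub) :
    (∃ p ∈ t.sub, s = p.subst σ) ∨ ∃ x ∈ t.vars, s ∈ (σ x).sub := by
  induction t with
  | var x => exact Or.inr ⟨x, by simp, h⟩
  | app f ts ih =>
    rcases mem_sub_app.1 h with rfl | ⟨i, hi⟩
    · exact Or.inl ⟨app f ts, self_mem_sub _, rfl⟩
    · rcases ih i hi with ⟨p, hp, rfl⟩ | ⟨x, hx, hs⟩
      · exact Or.inl ⟨p, mem_sub_app.2 (Or.inr ⟨i, hp⟩), rfl⟩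
      · exact Or.inr ⟨x, mem_vars_app.2 ⟨i, hx⟩, hs⟩

theorem mem_vars_subst {t : Term ar} {σ : ℕ → Term ar} {z : ℕ} :
    z ∈ (t.subst σ).vars ↔ ∃ x ∈ t.vars, z ∈ (σ x).vars := by
  induction t with
  | var x => simp
  | app f ts ih =>
    simp only [subst_app, mem_vars_app, ih]
    constructor
    · rintro ⟨i, x, hx, hz⟩
      exact ⟨x, ⟨i, hx⟩, hz⟩
    · rintro ⟨x, ⟨i, hx⟩, hz⟩
      exact ⟨i, x, hx, hz⟩

theorem symbols_subst_subset {t : Term ar} {σ : ℕ → Term ar} {S : Set F} (ht : t.symbols ⊆ S)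
    (hσ : ∀ x ∈ t.vars, (σ x).symbols ⊆ S) : (t.subst σ).symbols ⊆ S := by
  rintro f ⟨ts, hts⟩
  rcases mem_sub_subst hts with ⟨p, hp, hpe⟩ | ⟨x, hx, h⟩
  · cases p with
    | var x => exact hσ x hp ⟨ts, by rw [hpe]; exact self_mem_sub _⟩
    | app g us =>
      cases hpe
      exact ht ⟨us, hp⟩
  · exact hσ x hx ⟨ts, h⟩

/-! ### Finiteness -/

theorem finite_positions (t : Term ar) : {α | ∃ s, t.subAt α = some s}.Finite := by
  induction t with
  | var x =>
    refine (Set.finite_singleton ([] : List ℕ)).subset ?_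
    rintro (_ | ⟨i, α⟩) ⟨s, hs⟩
    · rfl
    · simp at hs
  | app f ts ih =>
    refine ((Set.finite_singleton ([] : List ℕ)).union
      (Set.finite_iUnion fun i : Fin (ar f) => (ih i).image (List.cons (i : ℕ)))).subset ?_
    rintro (_ | ⟨i, α⟩) ⟨s, hs⟩
    · exact Or.inl rfl
    · obtain ⟨j, rfl, hj⟩ := subAt_app_cons_eq_some hs
      exact Or.inr (Set.mem_iUnion.2 ⟨j, α, ⟨s, hj⟩, rfl⟩)

theorem finite_sub (t : Term ar) : t.sub.Finite := by
  induction t with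
  | var x => exact (Set.finite_singleton (var x)).subset fun s hs => mem_sub_var.1 hs
  | app f ts ih =>
    refine ((Set.finite_singleton (app f ts)).union (Set.finite_iUnion ih)).subset ?_
    intro s hs
    simpa using mem_sub_app.1 hs

theorem finite_vars (t : Term ar) : t.vars.Finite :=
  t.finite_sub.preimage (f := var) fun _ _ _ _ h => by cases h; rfl

/-- The arguments may be instantiated independently of each other; this only enlarges the set, to
the image of a finite product. -/
theorem finite_instances (p : Term ar) {A : Set (Term ar)} (hA : A.Finite) :
    {t | ∃ e : ℕ → Term ar, (∀ x ∈ p.vars, e x ∈ A) ∧ t = p.subst e}.Finite := by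
  induction p with
  | var x =>
    refine hA.subset ?_
    rintro _ ⟨e, he, rfl⟩
    exact he x (by simp)
  | app f ts ih =>
    refine ((Set.Finite.pi' ih).image (app f)).subset ?_
    rintro _ ⟨e, he, rfl⟩
    exact ⟨fun i => (ts i).subst e, fun i => ⟨e, fun x hx => he x (mem_vars_app.2 ⟨i, hx⟩), rfl⟩,
      rfl⟩

/-! ### Shapes -/

/-- `t` has the symbols of `K` at the positions where `K` has symbols. -/
def Fits : Term ar → Term ar → Prop
  | var _, _ => True
  | app f Ks, t => ∃ ts : Fin (ar f) → Term ar, t = app f ts ∧ ∀ i, Fits (Ks i) (ts i)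

theorem fits_app {f : F} {Ks ts : Fin (ar f) → Term ar} :
    (app f Ks).Fits (app f ts) ↔ ∀ i, (Ks i).Fits (ts i) := by
  constructor
  · rintro ⟨us, h, hus⟩
    cases h
    exact hus
  · exact fun h => ⟨ts, rfl, h⟩

theorem fits_subst (K : Term ar) (σ : ℕ → Term ar) : K.Fits (K.subst σ) := by
  induction K with
  | var x => trivial
  | app f Ks ih => exact fits_app.2 ih

theorem Fits.subst_eq {K t : Term ar} (h : K.Fits t) {ρ : ℕ → Term ar}
    (hρ : ∀ γ y, K.subAt γ = some (var y) → t.subAt γ = some (ρ y)) : K.subst ρ = t := by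
  induction K generalizing t with
  | var x =>
    have := hρ [] x (by simp)
    simpa using this.symm
  | app f Ks ih =>
    obtain ⟨ts, rfl, hts⟩ := h
    simp only [subst_app, app.injEq, heq_eq_eq, true_and]
    exact funext fun i => ih i (hts i) fun γ y hy => by
      simpa using hρ (i :: γ) y (by simpa using hy)

theorem Fits.subAt {K t : Term ar} (h : K.Fits t) {γ : List ℕ} {u : Term ar}
    (hu : K.subAt γ = some u) : ∃ s, t.subAt γ = some s := by
  induction K generalizing t γ with
  | var x =>
    cases γ with
    | nil => exact ⟨t, by simp⟩
    | cons i γ => simp at hu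
  | app f Ks ih =>
    obtain ⟨ts, rfl, hts⟩ := h
    cases γ with
    | nil => exact ⟨_, subAt_nil _⟩
    | cons i γ =>
      obtain ⟨j, rfl, hj⟩ := subAt_app_cons_eq_some hu
      simpa using ih j (hts j) hj

/-- The position of a variable in a term that fits is the position of a variable in the shape,
if it is a position of the shape at all. -/
theorem Fits.subAt_of_var {K t u : Term ar} (h : K.Fits t) {γ : List ℕ} {x : ℕ}
    (ht : t.subAt γ = some (var x)) (hu : K.subAt γ = some u) : u.IsVar := by
  induction K generalizing t γ with
  | var y =>
    cases γ with
    | nil => simp at hu; exact ⟨y, hu.symm⟩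
    | cons i γ => simp at hu
  | app f Ks ih =>
    obtain ⟨ts, rfl, hts⟩ := h
    cases γ with
    | nil => simp at ht
    | cons i γ =>
      obtain ⟨j, rfl, hj⟩ := subAt_app_cons_eq_some hu
      exact ih j (hts j) (by simpa using ht) hj

/-- Relabelling: the variable at the position `γ` becomes `g γ`. -/
def label : (List ℕ → ℕ) → Term ar → Term ar
  | g, var _ => var (g [])
  | g, app f ts => app f fun i => label (fun γ => g (i :: γ)) (ts i)

theorem Fits.label {K t : Term ar} (h : K.Fits t) (g : List ℕ → ℕ) : (K.label g).Fits t := by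
  induction K generalizing t g with
  | var x => trivial
  | app f Ks ih =>
    obtain ⟨ts, rfl, hts⟩ := h
    exact fits_app.2 fun i => ih i (hts i) _

theorem label_subAt_var {K : Term ar} {g : List ℕ → ℕ} {γ : List ℕ} {y : ℕ}
    (h : (K.label g).subAt γ = some (var y)) : y = g γ ∧ ∃ z, K.subAt γ = some (var z) := by
  induction K generalizing g γ with
  | var x =>
    cases γ with
    | nil => simp [label] at h; exact ⟨h.symm, x, by simp⟩
    | cons i γ => simp [label] at h
  | app f Ks ih =>
    cases γ with
    | nil => simp [label] at h
    | cons i γ =>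
      obtain ⟨j, rfl, hj⟩ := subAt_app_cons_eq_some h
      simpa using ih j hj

theorem subAt_label {K : Term ar} (g : List ℕ → ℕ) {γ : List ℕ} {z : ℕ}
    (h : K.subAt γ = some (var z)) : (K.label g).subAt γ = some (var (g γ)) := by
  induction K generalizing g γ with
  | var x =>
    cases γ with
    | nil => simp [label]
    | cons i γ => simp at h
  | app f Ks ih =>
    cases γ with
    | nil => simp at h
    | cons i γ =>
      obtain ⟨j, rfl, hj⟩ := subAt_app_cons_eq_some h
      simpa [label] using ih j _ hj

theorem label_linear (K : Term ar) {g : List ℕ → ℕ} (hg : g.Injective) : (K.label g).Linear := by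
  intro x α β hα hβ
  exact hg ((label_subAt_var hα).1.symm.trans (label_subAt_var hβ).1)

/-- Labelling by positions makes matching explicit: the variable at a position is sent to the
subterm of `t` there. With injective labels this exhibits a linear term having `t` as an instance,
which is how supertrees are produced. -/
theorem Fits.subst_label {K t : Term ar} (h : K.Fits t) {g : List ℕ → ℕ} {ρ : ℕ → Term ar}
    (hρ : ∀ γ s, t.subAt γ = some s → ρ (g γ) = s) : (K.label g).subst ρ = t := by
  refine (h.label g).subst_eq fun γ y hy => ?_
  obtain ⟨rfl, z, hz⟩ := label_subAt_var hy
  obtain ⟨s, hs⟩ := h.subAt hz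
  rw [hs, hρ γ s hs]

/-- The shape of a term: all variables are identified. -/
def shape (t : Term ar) : Term ar := t.subst fun _ => var 0

theorem fits_of_shape_eq {s t : Term ar} (h : s.shape = t.shape) : s.Fits t := by
  induction s generalizing t with
  | var x => trivial
  | app f ss ih =>
    cases t with
    | var y => simp [shape] at h
    | app g ts =>
      simp only [shape, subst_app, app.injEq] at h
      obtain ⟨rfl, h⟩ := h
      exact fits_app.2 fun i => ih i (congrFun (eq_of_heq h) i)

/-- A term that fits `t` arises by cutting `t` off at some positions, so only the names of its
variables leave infinitely many possibilities. -/
theorem finite_shapes (t : Term ar) : {K | ∃ s : Term ar, s.Fits t ∧ K = s.shape}.Finite := by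
  induction t with
  | var x =>
    refine (Set.finite_singleton (var 0)).subset ?_
    rintro _ ⟨s, hs, rfl⟩
    cases s with
    | var y => rfl
    | app f ss =>
      obtain ⟨ts, h, -⟩ := hs
      cases h
  | app f ts ih =>
    refine ((Set.finite_singleton (var 0)).union ((Set.Finite.pi' ih).image (app f))).subset ?_
    rintro _ ⟨s, hs, rfl⟩
    cases s with
    | var y => exact Or.inl rfl
    | app g ss =>
      obtain ⟨us, h, hus⟩ := hs
      cases h
      exact Or.inr ⟨fun i => (ss i).shape, fun i => ⟨ss i, hus i, rfl⟩, rfl⟩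

end Term

theorem subset_subLang {F : Type} {ar : F → ℕ} (L : Set (Term ar)) : L ⊆ subLang L :=
  fun t ht => Set.mem_biUnion ht t.self_mem_sub

theorem subLang_mono {F : Type} {ar : F → ℕ} {L L' : Set (Term ar)} (h : L ⊆ L') :
    subLang L ⊆ subLang L' := Set.biUnion_subset_biUnion_left h

theorem subLang_sub {F : Type} {ar : F → ℕ} {L : Set (Term ar)} {s t : Term ar}
    (ht : t ∈ subLang L) (hs : s ∈ t.sub) : s ∈ subLang L := by
  obtain ⟨u, hu, htu⟩ := Set.mem_iUnion₂.1 ht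
  exact Set.mem_iUnion₂.2 ⟨u, hu, Term.sub_trans hs htu⟩

theorem finite_subLang {F : Type} {ar : F → ℕ} {L : Set (Term ar)} (h : L.Finite) :
    (subLang L).Finite := h.biUnion fun t _ => t.finite_sub

/-! ## Most general unifiers

A most general unifier is obtained as the least general generalization of the family of all
unifiers. -/

namespace Term

variable {F : Type} {ar : F → ℕ}

/-- The argument number `i` of a term. -/
def argAt (i : ℕ) (t : Term ar) : Term ar := (t.subAt [i]).getD t

theorem argAt_app (f : F) (ts : Fin (ar f) → Term ar) (i : Fin (ar f)) :
    argAt i (app f ts) = ts i := by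
  simp [argAt]

open Classical in
/-- The generalization of a family `φ` of terms, one of which is the first argument: its symbols are
the common symbols of the family, and a subfamily without a common symbol at the root is replaced by
the variable that `name` gives to it. -/
noncomputable def gen {U : Type*} (name : (U → Term ar) → ℕ) : Term ar → (U → Term ar) → Term ar
  | var _, φ => var (name φ)
  | app f ts, φ =>
    if ∀ θ, ∃ us : Fin (ar f) → Term ar, φ θ = app f us then
      app f fun i => gen name (ts i) fun θ => argAt i (φ θ)
    else var (name φ)

theorem gen_app {U : Type*} (name : (U → Term ar) → ℕ) (θ₀ : U) {f : F}
    (φ : Fin (ar f) → U → Term ar) :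
    gen name (app f fun i => φ i θ₀) (fun θ => app f fun i => φ i θ) =
      app f fun i => gen name (φ i θ₀) (φ i) := by
  rw [gen, if_pos fun θ => ⟨_, rfl⟩]
  simp only [argAt_app]

/-- Generalization commutes with substitution. Applied to two sides that every unifier identifies,
it shows that the generalization of all unifiers is again a unifier. -/
theorem gen_subst {U : Type*} (name : (U → Term ar) → ℕ) (θ₀ : U) (val : U → ℕ → Term ar)
    (s : Term ar) :
    gen name (s.subst (val θ₀)) (fun θ => s.subst (val θ)) =
      s.subst fun x => gen name (val θ₀ x) fun θ => val θ x := by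
  induction s with
  | var x => rfl
  | app f ts ih =>
    simp only [subst_app]
    rw [gen_app name θ₀ fun i θ => (ts i).subst (val θ)]
    simp only [ih]

/-- Each member of the family is recovered by sending the name of a subfamily to its value at that
member. `P` restricts this to the subfamilies that occur, since names need to be injective only on
those. -/
theorem subst_gen {U : Type*} {name : (U → Term ar) → ℕ} {P : (U → Term ar) → Prop}
    (hP : ∀ (φ : U → Term ar) (f : F) (us : U → Fin (ar f) → Term ar), P φ →
      (∀ θ, φ θ = app f (us θ)) → ∀ i, P fun θ => us θ i)
    {τ : ℕ → Term ar} {θ : U} (hτ : ∀ φ, P φ → τ (name φ) = φ θ) (t : Term ar) (φ : U → Term ar)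
    (hφ : P φ) {θ₀ : U} (ht : t = φ θ₀) : (gen name t φ).subst τ = φ θ := by
  induction t generalizing φ with
  | var x => exact hτ φ hφ
  | app f ts ih =>
    rw [gen]
    split_ifs with h
    · choose us hus using h
      have hts : ts = us θ₀ := by
        have := ht.trans (hus θ₀)
        simpa using this
      rw [hus θ, subst_app]
      congr 1
      funext i
      have := ih i (fun θ => us θ i) (hP φ f us hφ hus i) (congrFun hts i)
      simpa only [hus, argAt_app] using this
    · exact hτ φ hφ

theorem exists_isMGU {s t : Term ar} {θ₀ : ℕ → Term ar} (h₀ : s.subst θ₀ = t.subst θ₀) :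
    ∃ σ, IsMGU σ s t := by
  classical
  let U := {θ : ℕ → Term ar // s.subst θ = t.subst θ}
  let u₀ : U := ⟨θ₀, h₀⟩
  -- These are the families of subterms at a fixed position below a fixed variable. There are
  -- countably many, since the variable and the position determine the family, although `U` itself
  -- may be uncountable.
  let P : (U → Term ar) → Prop := fun φ => ∃ (x : ℕ) (α : List ℕ),
    ∀ θ : U, (θ.1 x).subAt α = some (φ θ)
  have hcount : Countable {φ // P φ} := by
    choose x α h using fun φ : {φ // P φ} => φ.2
    refine Function.Injective.countable (f := fun φ => (x φ, α φ)) fun φ ψ hφψ => ?_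
    simp only [Prod.mk.injEq] at hφψ
    refine Subtype.ext (funext fun θ => ?_)
    have h1 := h φ θ
    rw [hφψ.1, hφψ.2, h ψ θ] at h1
    exact (Option.some.inj h1).symm
  obtain ⟨nm, hnm⟩ := exists_injective_nat {φ // P φ}
  -- The value `0` outside of `P` plays no role, because the recursion stays inside `P`.
  let name : (U → Term ar) → ℕ := fun φ => if h : P φ then nm ⟨φ, h⟩ else 0
  have hname : ∀ φ ψ, P φ → P ψ → name φ = name ψ → φ = ψ := by
    intro φ ψ hφ hψ h
    simp only [name, dif_pos hφ, dif_pos hψ] at h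
    exact congrArg Subtype.val (hnm h)
  have hP : ∀ (φ : U → Term ar) (f : F) (us : U → Fin (ar f) → Term ar), P φ →
      (∀ θ, φ θ = app f (us θ)) → ∀ i, P fun θ => us θ i := by
    rintro φ f us ⟨x, α, h⟩ hus i
    refine ⟨x, α ++ [(i : ℕ)], fun θ => ?_⟩
    rw [subAt_append (h θ), hus θ]
    simp
  refine ⟨fun x => gen name (u₀.1 x) fun θ : U => θ.1 x, ?_, fun θ hθ => ?_⟩
  · rw [← gen_subst name u₀ Subtype.val s, ← gen_subst name u₀ Subtype.val t, u₀.2]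
    congr 1
    funext θ
    exact θ.2
  · refine ⟨fun n => if h : ∃ φ, P φ ∧ name φ = n then h.choose ⟨θ, hθ⟩ else var n, fun x => ?_⟩
    refine (subst_gen (name := name) (P := P) (θ := ⟨θ, hθ⟩) hP ?_ (u₀.1 x)
      (fun θ : U => θ.1 x) ⟨x, [], fun θ => subAt_nil _⟩ (θ₀ := u₀) rfl).symm
    intro φ hφ
    have h : ∃ ψ, P ψ ∧ name ψ = name φ := ⟨φ, hφ, rfl⟩
    rw [dif_pos h]
    rw [hname _ _ h.choose_spec.1 hφ h.choose_spec.2]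

end Term

/-! ## Finiteness of the sets `E` and `D` -/

namespace TRS

open Term

variable {F : Type} {ar : F → ℕ}

/-- With equal shapes, `σ'` can be transported to a unifier of `u` and `l`, because `l` is linear
and shares no variable with `u`. It factors through the most general `σ`, and a ground value of `σ`
is not changed by the second factor. -/
theorem overlap_value_unique {l₁ u l l' w w' : Term ar} {σ σ' : ℕ → Term ar} {γ : List ℕ} {y y' : ℕ}
    (hu : u.vars ⊆ l₁.vars) (hl : l.Linear) (hd : Disjoint l.vars l₁.vars) (hσ : IsMGU σ u l)
    (hσ' : IsMGU σ' u l') (hs : l.shape = l'.shape) (hw : l.subAt γ = some w)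
    (hw' : l'.subAt γ = some w') (hwy : w = var y) (hwy' : w' = var y')
    (hg : (w.subst σ).IsGround) : w.subst σ = w'.subst σ' := by
  classical
  subst hwy hwy'
  have hfit : l.Fits l' := fits_of_shape_eq hs
  -- On the variables of `l` the values are read off from `l'.subst σ'`; on all others, in
  -- particular on those of `u`, `θ` is `σ'`.
  let θ : ℕ → Term ar := fun z =>
    if h : ∃ α, l.subAt α = some (var z) then ((l'.subst σ').subAt h.choose).getD (var 0) else σ' z
  have hθ : ∀ α z, l.subAt α = some (var z) → (l'.subst σ').subAt α = some (θ z) := by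
    intro α z hz
    have h : ∃ α, l.subAt α = some (var z) := ⟨α, hz⟩
    have hα : h.choose = α := hl z _ _ h.choose_spec hz
    obtain ⟨s, hs⟩ := hfit.subAt hz
    have := subAt_subst hs σ'
    simp only [θ, dif_pos h, hα, this, Option.getD_some]
  have hfit' : l.Fits (l'.subst σ') := by
    clear * - hfit
    induction l generalizing l' with
    | var x => trivial
    | app f ls ih =>
      obtain ⟨ts, rfl, hts⟩ := hfit
      exact fits_app.2 fun i => ih i (hts i)
  have hlθ : l.subst θ = l'.subst σ' := hfit'.subst_eq hθ
  have huθ : u.subst θ = u.subst σ' := by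
    refine subst_congr fun x hx => ?_
    have : ¬ ∃ α, l.subAt α = some (var x) := fun h => Set.disjoint_left.1 hd h (hu hx)
    simp only [θ, dif_neg this]
  obtain ⟨τ, hτ⟩ := hσ.2 θ (by rw [huθ, hlθ, hσ'.1])
  have h1 := hθ γ y hw
  rw [subAt_subst hw' σ', hτ y] at h1
  rw [Option.some.inj h1]
  exact (hg.subst_eq τ).symm

theorem finite_setE (R : TRS ar) : R.setE.Finite := by
  -- All data are fixed except the names of variables and the choice of the unifier; each such set
  -- has at most one element.
  let S (a : Term ar × Term ar) (b : Term ar × Term ar) (α β γ : List ℕ) (K : Term ar) :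
      Set (Term ar) :=
    {t | t.IsGround ∧ ∃ (u v l₃ w : Term ar) (σ : ℕ → Term ar) (x : ℕ), a ∈ R.rules ∧
      a.2.subAt α = some u ∧ b.1.subAt β = some v ∧ l₃.Supertree v ∧ Disjoint l₃.vars a.1.vars ∧
      IsMGU σ u l₃ ∧ l₃.shape = K ∧ l₃.subAt γ = some w ∧ v.subAt γ = some (var x) ∧
      t = w.subst σ}
  have hS : ∀ a b α β γ K, (S a b α β γ K).Subsingleton := by
    rintro ⟨l₁, r₁⟩ b α β γ K t
      ⟨hg, u, v, l₃, w, σ, x, ha, hu, hv, hst, hd, hσ, hK, hw, hx, rfl⟩ t'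
      ⟨hg', u', v', l₃', w', σ', x', ha', hu', hv', hst', hd', hσ', hK', hw', hx', rfl⟩
    obtain rfl : u = u' := Option.some.inj (hu.symm.trans hu')
    obtain rfl : v = v' := Option.some.inj (hv.symm.trans hv')
    obtain ⟨hlin, ρ, hρ⟩ := hst
    obtain ⟨hlin', ρ', hρ'⟩ := hst'
    have hf : l₃.Fits v := by rw [hρ]; exact fits_subst _ _
    have hf' : l₃'.Fits v := by rw [hρ']; exact fits_subst _ _
    obtain ⟨y, rfl⟩ := hf.subAt_of_var hx hw
    obtain ⟨y', rfl⟩ := hf'.subAt_of_var hx' hw'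
    exact overlap_value_unique (l₁ := l₁)
      ((vars_subset_of_mem_sub ⟨α, hu⟩).trans (R.vars_subset _ _ ha)) hlin hd hσ hσ'
      (hK.trans hK'.symm) hw hw' rfl rfl hg
  have hfin : (⋃ a ∈ R.rules, ⋃ b ∈ R.rules, ⋃ α ∈ {α | ∃ s, a.2.subAt α = some s},
      ⋃ β ∈ {β | ∃ s, b.1.subAt β = some s},
      ⋃ γ ∈ {γ | ∃ s, ((b.1.subAt β).getD (var 0)).subAt γ = some s},
      ⋃ K ∈ {K | ∃ s : Term ar, s.Fits ((b.1.subAt β).getD (var 0)) ∧ K = s.shape},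
        S a b α β γ K).Finite :=
    R.finite.biUnion fun a _ => R.finite.biUnion fun b _ => (finite_positions _).biUnion fun α _ =>
      (finite_positions _).biUnion fun β _ => (finite_positions _).biUnion fun γ _ =>
      (finite_shapes _).biUnion fun K _ => (hS a b α β γ K).finite
  refine hfin.subset ?_
  rintro t ⟨hg, l₂, β, l₃, σ, ⟨l₁, r₁, r₂, h1, h2, α, u, v, hu, hv, -, hst, hd, hσ⟩, -, γ, w, hw,
    ⟨x, hx⟩, rfl⟩
  rw [subAt_append hv] at hx
  obtain ⟨ρ, hρ⟩ := hst.2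
  simp only [Set.mem_iUnion]
  refine ⟨(l₁, r₁), h1, (l₂, r₂), h2, α, ⟨u, hu⟩, β, ⟨v, hv⟩, γ, ⟨var x, by simpa [hv] using hx⟩,
    l₃.shape, ⟨l₃, by simp only [hv, Option.getD_some]; rw [hρ]; exact fits_subst _ _, rfl⟩, ?_⟩
  exact ⟨hg, u, v, l₃, w, σ, x, h1, hu, hv, hst, hd, hσ, rfl, hw, hx, rfl⟩

theorem finite_setD (R : TRS ar) {L : Set (Term ar)} (hL : L.Finite) : (R.setD L).Finite := by
  have hA : (subLang (L ∪ R.setE)).Finite := finite_subLang (hL.union R.finite_setE)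
  refine (finite_subLang hL).union ((R.finite.biUnion fun a _ => (finite_sub a.2).biUnion
    fun p _ => finite_instances p hA).subset ?_)
  rintro t ⟨l, r, p, e, hlr, hp, he, rfl⟩
  simp only [Set.mem_iUnion]
  exact ⟨(l, r), hlr, p, hp, e, he, rfl⟩

end TRS

/-! ## Runs of tree automata -/

section Runs

open Term Relation

variable {F : Type} {ar : F → ℕ}

theorem Reduces.app {R : Set (Term ar × Term ar)} {f : F} {ts us : Fin (ar f) → Term ar}
    (h : ∀ i, Reduces R (ts i) (us i)) : Reduces R (Term.app f ts) (Term.app f us) := by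
  classical
  have key : ∀ (vs : Fin (ar f) → Term ar) (i : Fin (ar f)) (s : Term ar), Reduces R (vs i) s →
      Reduces R (Term.app f vs) (Term.app f (Function.update vs i s)) := by
    intro vs i s hs
    induction hs with
    | refl => rw [Function.update_eq_self]; exact ReflTransGen.refl
    | tail _ h2 ih =>
      refine ih.tail ?_
      have := Step.arg f (Function.update vs i _) i _ (by rw [Function.update_self]; exact h2)
      rwa [Function.update_idem] at this
  -- `S` is the set of the arguments that have already been rewritten.
  have : ∀ S : Finset (Fin (ar f)),
      Reduces R (Term.app f ts) (Term.app f fun i => if i ∈ S then us i else ts i) := by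
    intro S
    induction S using Finset.induction_on with
    | empty => simp; exact ReflTransGen.refl
    | insert j S hj ih =>
      refine ih.trans ?_
      have h1 := key (fun i => if i ∈ S then us i else ts i) j (us j) (by simpa [hj] using h j)
      have h2 : (fun i => if i ∈ insert j S then us i else ts i) =
          Function.update (fun i => if i ∈ S then us i else ts i) j (us j) := by
        funext i
        by_cases hij : i = j
        · subst hij; simp
        · simp [hij]
      rw [h2]
      exact h1
  simpa using this Finset.univ

variable {Q : Type}

/-- The term `t` can be evaluated to the state `q` by the symbol rules `Δ` and the state changes
`Λ`, if the possible values of the variables are given by `V`. -/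
def run (Δ : (f : F) → (Fin (ar f) → Q) → Q → Prop) (Λ : Q → Q → Prop) (V : ℕ → Q → Prop) :
    Term ar → Q → Prop
  | var x, q => V x q
  | Term.app f ts, q => ∃ (as : Fin (ar f) → Q) (a : Q), Δ f as a ∧
      (∀ i, run Δ Λ V (ts i) (as i)) ∧ ReflTransGen Λ a q

variable {Δ : (f : F) → (Fin (ar f) → Q) → Q → Prop} {Λ : Q → Q → Prop} {V W : ℕ → Q → Prop}

theorem run_mono {t : Term ar} {q : Q} (h : run Δ Λ V t q)
    (hVW : ∀ x ∈ t.vars, ∀ q, V x q → W x q) : run Δ Λ W t q := by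
  induction t generalizing q with
  | var x => exact hVW x (by simp) q h
  | app f ts ih =>
    obtain ⟨as, a, hΔ, has, ha⟩ := h
    exact ⟨as, a, hΔ, fun i => ih i (has i) fun x hx => hVW x (mem_vars_app.2 ⟨i, hx⟩), ha⟩

/-- Splits a run on `tθ` into a run on `t` and runs on the values of `θ`; repeated variables may
receive different states. -/
theorem run_subst {t : Term ar} {θ : ℕ → Term ar} {q : Q} :
    run Δ Λ V (t.subst θ) q ↔ run Δ Λ (fun x => run Δ Λ V (θ x)) t q := by
  induction t generalizing q with
  | var x => rfl
  | app f ts ih => simp only [subst_app, run, ih]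

theorem run_trans (hV : ∀ x a b, V x a → Λ a b → V x b) {t : Term ar} {a b : Q}
    (h : run Δ Λ V t a) (hab : ReflTransGen Λ a b) : run Δ Λ V t b := by
  cases t with
  | var x =>
    induction hab with
    | refl => exact h
    | tail _ h2 ih => exact hV _ _ _ ih h2
  | app f ts =>
    obtain ⟨as, c, hΔ, has, hc⟩ := h
    exact ⟨as, c, hΔ, has, hc.trans hab⟩

/-- Evaluation of terms that contain states. -/
def eval (Δ : (f : F) → (Fin (ar f) → Q) → Q → Prop) (Λ : Q → Q → Prop) :
    Term (stateRank ar Q) → Q → Prop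
  | var _, _ => False
  | Term.app (Sum.inr p) _, q => ReflTransGen Λ p q
  | Term.app (Sum.inl f) ts, q => ∃ (as : Fin (ar f) → Q) (a : Q), Δ f as a ∧
      (∀ i : Fin (ar f), eval Δ Λ (ts i) (as i)) ∧ ReflTransGen Λ a q

theorem eval_lift_subst {t : Term ar} {e : ℕ → Q} {q : Q} :
    eval Δ Λ ((t.lift Q).subst fun x => stateTerm ar (e x)) q ↔
      run Δ Λ (fun x => ReflTransGen Λ (e x)) t q := by
  induction t generalizing q with
  | var x => rfl
  | app f ts ih => simp only [run, ← ih]; rfl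

/-- `S` consists of the symbol rules `Δ` and the rules `a → b` with `Λ a b`. -/
def RulesOf (S : Set (Term (stateRank ar Q) × Term (stateRank ar Q)))
    (Δ : (f : F) → (Fin (ar f) → Q) → Q → Prop) (Λ : Q → Q → Prop) : Prop :=
  ∀ ρ, ρ ∈ S ↔ (∃ f as a, Δ f as a ∧ ρ = symbolRule ar f as a) ∨
    ∃ a b, Λ a b ∧ ρ = lambdaRule ar a b

theorem stateTerm_subst (q : Q) (σ : ℕ → Term (stateRank ar Q)) :
    (stateTerm ar q).subst σ = stateTerm ar q :=
  congrArg (Term.app (ar := stateRank ar Q) (Sum.inr q)) (funext fun i => Fin.elim0 i)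

theorem app_state_eq (q : Q) (ts : Fin (stateRank ar Q (Sum.inr q)) → Term (stateRank ar Q)) :
    Term.app (ar := stateRank ar Q) (Sum.inr q) ts = stateTerm ar q :=
  congrArg (Term.app (ar := stateRank ar Q) (Sum.inr q)) (funext fun i => Fin.elim0 i)

/-- Evaluation is pulled back along steps because the rules are ground: a state on the right is
replaced by a term that evaluates to it. Reductions thereby become structured runs. -/
theorem eval_of_step {S : Set (Term (stateRank ar Q) × Term (stateRank ar Q))}
    (hS : RulesOf S Δ Λ) {s t : Term (stateRank ar Q)} (h : Step S s t) {q : Q}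
    (ht : eval Δ Λ t q) : eval Δ Λ s q := by
  induction h generalizing q with
  | root l r σ hlr =>
    rcases (hS _).1 hlr with ⟨f, as, a, hΔ, h⟩ | ⟨a, b, hab, h⟩
    · cases h
      rw [stateTerm_subst] at ht
      simp only [subst_app, stateTerm_subst]
      exact ⟨as, a, hΔ, fun i => ReflTransGen.refl, ht⟩
    · cases h
      rw [stateTerm_subst] at ht ⊢
      exact ReflTransGen.head hab ht
  | arg g ts i s h ih =>
    rcases g with f | p
    · obtain ⟨as, a, hΔ, has, ha⟩ := ht
      refine ⟨as, a, hΔ, fun j => ?_, ha⟩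
      have hj : eval Δ Λ (Function.update ts i s j) (as j) := has j
      by_cases hij : j = i
      · subst hij
        exact ih (Eq.mp (congrArg (fun u => eval Δ Λ u (as j)) (Function.update_self j s ts)) hj)
      · exact Eq.mp (congrArg (fun u => eval Δ Λ u (as j)) (Function.update_of_ne hij s ts)) hj
    · exact Fin.elim0 i

theorem reduces_of_eval {S : Set (Term (stateRank ar Q) × Term (stateRank ar Q))}
    (hS : RulesOf S Δ Λ) {t : Term (stateRank ar Q)} {q : Q} (h : eval Δ Λ t q) :
    Reduces S t (stateTerm ar q) := by
  have hΛ : ∀ a b, ReflTransGen Λ a b → Reduces S (stateTerm ar a) (stateTerm ar b) := by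
    intro a b hab
    refine ReflTransGen.lift (p := Step S) (stateTerm ar) (fun a b hab => ?_) a b hab
    have := Step.root (R := S) (stateTerm ar a) (stateTerm ar b) var
      ((hS _).2 (Or.inr ⟨a, b, hab, rfl⟩))
    simpa only [stateTerm_subst] using this
  induction t generalizing q with
  | var x => exact h.elim
  | app g ts ih =>
    rcases g with f | p
    · obtain ⟨as, a, hΔ, has, ha⟩ := h
      refine (Reduces.app (ar := stateRank ar Q) (f := Sum.inl f)
        (us := fun i : Fin (ar f) => stateTerm ar (as i)) fun i => ih i (has i)).trans
        (ReflTransGen.head ?_ (hΛ _ _ ha))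
      have := Step.root (R := S) _ _ var ((hS _).2 (Or.inl ⟨f, as, a, hΔ, rfl⟩))
      simp only [stateTerm_subst, subst_app] at this
      exact this
    · rw [app_state_eq]
      exact hΛ _ _ h

theorem reduces_iff_eval {S : Set (Term (stateRank ar Q) × Term (stateRank ar Q))}
    (hS : RulesOf S Δ Λ) {t : Term (stateRank ar Q)} {q : Q} :
    Reduces S t (stateTerm ar q) ↔ eval Δ Λ t q := by
  refine ⟨fun h => ?_, reduces_of_eval hS⟩
  induction h using ReflTransGen.head_induction_on with
  | refl => exact ReflTransGen.refl
  | head h _ ih => exact eval_of_step hS h ih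

theorem reduces_subst_iff_run {S : Set (Term (stateRank ar Q) × Term (stateRank ar Q))}
    (hS : RulesOf S Δ Λ) {t : Term ar} {e : ℕ → Q} {q : Q} :
    Reduces S ((t.lift Q).subst fun x => stateTerm ar (e x)) (stateTerm ar q) ↔
      run Δ Λ (fun x => ReflTransGen Λ (e x)) t q :=
  (reduces_iff_eval hS).trans eval_lift_subst

theorem eval_lift {t : Term ar} {q : Q} :
    eval Δ Λ (t.lift Q) q ↔ run Δ Λ (fun _ _ => False) t q := by
  induction t generalizing q with
  | var x => rfl
  | app f ts ih => simp only [run, ← ih]; rfl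

theorem reduces_iff_run {S : Set (Term (stateRank ar Q) × Term (stateRank ar Q))}
    (hS : RulesOf S Δ Λ) {t : Term ar} {q : Q} :
    Reduces S (t.lift Q) (stateTerm ar q) ↔ run Δ Λ (fun _ _ => False) t q :=
  (reduces_iff_eval hS).trans eval_lift

end Runs

/-! ## Saturated automata -/

/-- The symbol rules of the automaton whose states are terms, where `δ(p₁, …, pₘ)` is the value of
the symbol `δ` at `p₁, …, pₘ`. -/
def termRules {F : Type} {ar : F → ℕ} (Sg : Set F) (X : Set (Term ar)) (f : F)
    (ps : Fin (ar f) → Term ar) (a : Term ar) : Prop :=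
  f ∈ Sg ∧ (∀ i, ps i ∈ X) ∧ Term.app f ps ∈ X ∧ a = Term.app f ps

/-- The automaton with the states `X`, the symbol rules of `termRules` and the state changes `Λ` is
saturated for `R`, the substitutions being those with values in `A`. -/
structure IsSaturated {F : Type} {ar : F → ℕ} (R : TRS ar) (Sg : Set F) (A X : Set (Term ar))
    (Λ : Term ar → Term ar → Prop) : Prop where
  sign_subset : R.sign ⊆ Sg
  sub_mem : ∀ t ∈ A, ∀ s ∈ t.sub, s ∈ A
  setE_subset : R.setE ⊆ A
  inst_mem : ∀ l r p (e : ℕ → Term ar), (l, r) ∈ R.rules → p ∈ r.sub → (∀ x ∈ p.vars, e x ∈ A) →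
    p.subst e ∈ X
  mem_cases : ∀ q ∈ X, q ∈ A ∨ ∃ (l r p : Term ar) (e : ℕ → Term ar), (l, r) ∈ R.rules ∧
    p ∈ r.sub ∧ (∀ x ∈ p.vars, e x ∈ A) ∧ q = p.subst e
  source : ∀ a b, Λ a b → a = b ∨ ∃ (l r : Term ar) (e : ℕ → Term ar), (l, r) ∈ R.rules ∧
    (∀ x ∈ l.vars, e x ∈ A) ∧ a = r.subst e
  target : ∀ a b, Λ a b → b ∈ X
  sound : ∀ a b, Λ a b → Reduces R.rules b a
  closed : ∀ l r (e : ℕ → Term ar) c, (l, r) ∈ R.rules → (∀ x ∈ l.vars, e x ∈ A) → c ∈ X →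
    run (termRules Sg X) Λ (fun x => Relation.ReflTransGen Λ (e x)) l c →
      Relation.ReflTransGen Λ (r.subst e) c

/-! ### Soundness: a run is a reduction read backwards. -/

section Soundness

open Term Relation

variable {F : Type} {ar : F → ℕ} {R : Set (Term ar × Term ar)} {Sg : Set F} {X : Set (Term ar)}
  {Λ : Term ar → Term ar → Prop}

theorem reduces_of_reflTransGen (hΛ : ∀ a b, Λ a b → Reduces R b a) {a b : Term ar}
    (h : ReflTransGen Λ a b) : Reduces R b a := by
  induction h with
  | refl => exact ReflTransGen.refl
  | tail _ h2 ih => exact (hΛ _ _ h2).trans ih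

theorem reduces_of_run (hΛ : ∀ a b, Λ a b → Reduces R b a) {V : ℕ → Term ar → Prop}
    {θ : ℕ → Term ar} (hV : ∀ x q, V x q → Reduces R q (θ x)) {t q : Term ar}
    (h : run (termRules Sg X) Λ V t q) : Reduces R q (t.subst θ) := by
  induction t generalizing q with
  | var x => exact hV x q h
  | app f ts ih =>
    obtain ⟨as, a, ⟨-, -, -, rfl⟩, has, ha⟩ := h
    exact (reduces_of_reflTransGen hΛ ha).trans (Reduces.app fun i => ih i (has i))

end Soundness

/-! ### Completeness: runs survive rewriting. -/

namespace IsSaturated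

open Term Relation

variable {F : Type} {ar : F → ℕ} {R : TRS ar} {Sg : Set F} {A X : Set (Term ar)}
  {Λ : Term ar → Term ar → Prop}

/-- The values that an instance of a right-hand side gives to the variables of an overlapping
left-hand side belong to `A`. -/
theorem overlap_value_mem (hs : IsSaturated R Sg A X Λ) (hgsm : R.IsGSM)
    {l₁ r₁ l r u v K d : Term ar} {α β γ : List ℕ} {e : ℕ → Term ar} {x : ℕ} {w : Term ar}
    (h₁ : (l₁, r₁) ∈ R.rules) (h : (l, r) ∈ R.rules) (hu : r₁.subAt α = some u)
    (hv : l.subAt β = some v) (hαβ : α = [] ∨ β = []) (hvv : ¬ v.IsVar) (hK : ¬ K.IsVar)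
    (hKv : K.Fits v) (hKd : K.Fits d) (hd : d = u.subst e) (he : ∀ x ∈ u.vars, e x ∈ A)
    (hγK : ∃ y, K.subAt γ = some (var y)) (hγv : v.subAt γ = some (var x))
    (hγd : d.subAt γ = some w) : w ∈ A := by
  classical
  obtain ⟨N, hN⟩ := l₁.finite_vars.bddAbove
  -- Labels above `N` are fresh for `l₁`, so the relabelled shape satisfies the disjointness
  -- condition of overlaps.
  let g : List ℕ → ℕ := fun γ => N + 1 + Encodable.encode γ
  have hg : g.Injective := fun a b hab => Encodable.encode_injective (Nat.add_left_cancel hab)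
  have hN' : ∀ x ∈ u.vars, x ≤ N := fun x hx =>
    hN (R.vars_subset _ _ h₁ (vars_subset_of_mem_sub ⟨α, hu⟩ hx))
  -- One substitution acts as `e` on the old variables and as matching on the fresh ones, so that it
  -- unifies `u` with the relabelled shape.
  have hmatch : ∀ (t : Term ar) (e : ℕ → Term ar), ∃ ρ : ℕ → Term ar,
      (∀ γ s, t.subAt γ = some s → ρ (g γ) = s) ∧ ∀ x ≤ N, ρ x = e x := by
    intro t e
    refine ⟨fun n => if n ≤ N then e n else if hn : ∃ γ, g γ = n then
      (t.subAt hn.choose).getD t else t, fun γ s hγ => ?_, fun x hx => if_pos hx⟩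
    have hn : ∃ γ', g γ' = g γ := ⟨γ, rfl⟩
    have h1 : ¬ g γ ≤ N := by simp only [g]; omega
    simp only [if_neg h1, dif_pos hn, hg hn.choose_spec, hγ, Option.getD_some]
  obtain ⟨θ, hθd, hθe⟩ := hmatch d e
  obtain ⟨ρ, hρ, -⟩ := hmatch v e
  have huθ : u.subst θ = d := by
    rw [hd]
    exact subst_congr fun x hx => hθe x (hN' x hx)
  have hKθ : (K.label g).subst θ = d := hKd.subst_label hθd
  obtain ⟨σ, hσ⟩ := exists_isMGU (huθ.trans hKθ.symm)
  obtain ⟨τ, hτ⟩ := hσ.2 θ (huθ.trans hKθ.symm)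
  have hdisj : Disjoint (K.label g).vars l₁.vars := by
    rw [Set.disjoint_left]
    rintro x ⟨δ, hδ⟩ hx
    have := hN hx
    rw [(label_subAt_var hδ).1] at this
    simp only [g] at this
    omega
  have hov : R.Overlap l β (K.label g) σ :=
    ⟨l₁, r₁, r, h₁, h, α, u, v, hu, hv, hαβ, ⟨label_linear K hg, ρ, (hKv.subst_label hρ).symm⟩,
      hdisj, hσ⟩
  obtain ⟨y, hy⟩ := hγK
  have hlγ := subAt_label g hy
  have hlv : ∃ x, l.subAt (β ++ γ) = some (var x) := ⟨x, by rw [subAt_append hv, hγv]⟩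
  have hw : w = ((var (g γ)).subst σ).subst τ := by
    rw [← hθd γ w hγd, hτ, subst_var]
  rcases hgsm.2 l β _ σ hov with ⟨z, hz⟩ | hcase
  · rw [hv] at hz
    exact absurd ⟨z, Option.some.inj hz⟩ hvv
  rcases hcase γ _ hlγ hlv with ⟨z, hz⟩ | hground
  -- The variable `z` occurs in the unified term, hence in some `σ x'` with `x'` in `u`. So `w`, the
  -- value of `τ` at `z`, is a subterm of `e x'`.
  · have hz' : z ∈ ((K.label g).subst σ).vars := by
      refine mem_vars_subst.2 ⟨g γ, ⟨γ, hlγ⟩, ?_⟩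
      rw [← subst_var σ, hz]
      simp
    rw [← hσ.1] at hz'
    obtain ⟨x', hx', hzx⟩ := mem_vars_subst.1 hz'
    rw [hw, hz]
    refine hs.sub_mem _ (he x' hx') _ ?_
    rw [← hθe x' (hN' x' hx'), hτ x']
    exact subst_mem_sub_subst hzx τ
  · rw [hw, hground.subst_eq]
    refine hs.setE_subset ⟨hground, l, β, _, σ, hov, ?_, γ, _, hlγ, hlv, rfl⟩
    rintro ⟨z, hz⟩
    cases K with
    | var k => exact hK ⟨k, rfl⟩
    | app f Ks => cases hz

theorem eq_or_source (hs : IsSaturated R Sg A X Λ) {a b : Term ar} (h : ReflTransGen Λ a b) :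
    a = b ∨ ∃ (l r : Term ar) (e : ℕ → Term ar), (l, r) ∈ R.rules ∧
      (∀ x ∈ l.vars, e x ∈ A) ∧ a = r.subst e := by
  induction h using ReflTransGen.head_induction_on with
  | refl => exact Or.inl rfl
  | head h1 _ ih =>
    rcases hs.source _ _ h1 with rfl | h
    · exact ih
    · exact Or.inr h

theorem mem_of_reflTransGen (hs : IsSaturated R Sg A X Λ) {a b : Term ar} (ha : a ∈ X)
    (h : ReflTransGen Λ a b) : b ∈ X := by
  induction h with
  | refl => exact ha
  | tail _ h2 _ => exact hs.target _ _ h2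

theorem linear_arg {f : F} {ts : Fin (ar f) → Term ar} (h : (app f ts).Linear) (i : Fin (ar f)) :
    (ts i).Linear := by
  intro x α β hα hβ
  have := h x (i :: α) (i :: β) (by simpa using hα) (by simpa using hβ)
  exact (List.cons.inj this).2

theorem linear_arg_unique {f : F} {ts : Fin (ar f) → Term ar} (h : (app f ts).Linear)
    {i j : Fin (ar f)} {x : ℕ} (hi : x ∈ (ts i).vars) (hj : x ∈ (ts j).vars) : i = j := by
  obtain ⟨α, hα⟩ := hi
  obtain ⟨β, hβ⟩ := hj
  have := h x (i :: α) (j :: β) (by simpa using hα) (by simpa using hβ)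
  exact Fin.ext (List.cons.inj this).1

/-- A run on a subterm `v` of a left-hand side can be described by values of the variables and a
common shape `K` of `v` and of the resulting state, such that the values at positions outside of the
shape belong to `A`. -/
theorem exists_shape (hs : IsSaturated R Sg A X Λ) (hgsm : R.IsGSM) {l r : Term ar}
    (h : (l, r) ∈ R.rules) {V : ℕ → Term ar → Prop} (v : Term ar) (hlin : v.Linear) {β : List ℕ}
    (hv : l.subAt β = some v) {d : Term ar} (hd : run (termRules Sg X) Λ V v d) :
    ∃ (s : ℕ → Term ar) (K : Term ar), (∀ x ∈ v.vars, V x (s x)) ∧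
      run (termRules Sg X) Λ (fun x q => q = s x) v d ∧ K.Fits v ∧ K.Fits d ∧
      (∀ γ x, v.subAt γ = some (var x) → s x ∈ A ∨
        (∃ y, K.subAt γ = some (var y)) ∧ d.subAt γ = some (s x)) ∧
      (v.IsVar ∨ ¬ K.IsVar ∨ ∀ x ∈ v.vars, s x ∈ A) := by
  classical
  induction v generalizing β d with
  | var x =>
    -- State changes made directly at a variable are absorbed into `V`, so the selected state is `d`
    -- itself.
    refine ⟨fun _ => d, var 0, fun y hy => ?_, rfl, trivial, trivial, fun γ y hγ => Or.inr ?_,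
      Or.inl ⟨x, rfl⟩⟩
    · rw [mem_vars_var.1 hy]; exact hd
    · cases γ <;> simp at hγ ⊢
  | app f vs ih =>
    obtain ⟨ps, a, hΔ, hps, ha⟩ := hd
    obtain ⟨-, -, -, rfl⟩ := id hΔ
    have hvi : ∀ i : Fin (ar f), l.subAt (β ++ [(i : ℕ)]) = some (vs i) := fun i => by
      rw [subAt_append hv]; simp
    choose s K hV hrun hKv hKd hpos _ using fun i =>
      ih i (linear_arg hlin i) (hvi i) (hps i)
    -- Linearity puts each variable into a single argument, so the selections for the arguments can
    -- be glued.
    let S : ℕ → Term ar := fun x => if hx : ∃ i, x ∈ (vs i).vars then s hx.choose x else var 0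
    have hS : ∀ i, ∀ x ∈ (vs i).vars, S x = s i x := by
      intro i x hx
      have hx' : ∃ i, x ∈ (vs i).vars := ⟨i, hx⟩
      simp only [S, dif_pos hx', linear_arg_unique hlin hx'.choose_spec hx]
    have hSV : ∀ x ∈ (app f vs).vars, V x (S x) := by
      intro x hx
      obtain ⟨i, hi⟩ := mem_vars_app.1 hx
      rw [hS i x hi]
      exact hV i x hi
    have hSrun : run (termRules Sg X) Λ (fun x q => q = S x) (app f vs) d :=
      ⟨ps, _, hΔ, fun i => run_mono (hrun i) fun x hx q hq => by rw [hq, hS i x hx], ha⟩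
    have hfv : (app f K).Fits (app f vs) := fits_app.2 hKv
    have hfd : (app f K).Fits (app f ps) := fits_app.2 hKd
    have hSpos : ∀ γ x, (app f vs).subAt γ = some (var x) → S x ∈ A ∨
        (∃ y, (app f K).subAt γ = some (var y)) ∧ (app f ps).subAt γ = some (S x) := by
      intro γ x hγ
      cases γ with
      | nil => simp at hγ
      | cons i γ =>
        obtain ⟨j, rfl, hj⟩ := subAt_app_cons_eq_some hγ
        rw [hS j x ⟨γ, hj⟩]
        simpa using hpos j γ x hj
    rcases hs.eq_or_source ha with rfl | ⟨l₁, r₁, e, h₁, he, hae⟩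
    · exact ⟨S, app f K, hSV, hSrun, hfv, hfd, hSpos, Or.inr (Or.inl fun ⟨y, hy⟩ => by cases hy)⟩
    -- At a nontrivial state change the state before it is an instance of a whole right-hand side.
    -- The overlap at its root settles all variables below, after which the shape may be cut off
    -- here.
    · have hSA : ∀ x ∈ (app f vs).vars, S x ∈ A := by
        rintro x ⟨γ, hγ⟩
        rcases hSpos γ x hγ with hA | ⟨hγK, hγd⟩
        · exact hA
        · exact hs.overlap_value_mem hgsm h₁ h (subAt_nil r₁) hv (Or.inl rfl)
            (fun ⟨y, hy⟩ => by cases hy) (fun ⟨y, hy⟩ => by cases hy) hfv hfd hae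
            (fun x hx => he x (R.vars_subset _ _ h₁ hx)) hγK hγ hγd
      exact ⟨S, var 0, hSV, hSrun, trivial, trivial, fun γ x hγ => Or.inl (hSA x ⟨γ, hγ⟩),
        Or.inr (Or.inr hSA)⟩

/-- A run on a left-hand side can be chosen such that the values of the variables belong to `A`. -/
theorem exists_values (hs : IsSaturated R Sg A X Λ) (hlin : R.LeftLinear) (hgsm : R.IsGSM)
    {l r : Term ar} (h : (l, r) ∈ R.rules) {V : ℕ → Term ar → Prop} {q : Term ar}
    (hq : run (termRules Sg X) Λ V l q) :
    q ∈ X ∧ ∃ s : ℕ → Term ar, (∀ x ∈ l.vars, V x (s x)) ∧ (∀ x ∈ l.vars, s x ∈ A) ∧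
      run (termRules Sg X) Λ (fun x q => q = s x) l q := by
  have hqX : q ∈ X := by
    cases l with
    | var x => exact absurd ⟨x, rfl⟩ (hgsm.1 _ _ h)
    | app f ls =>
      obtain ⟨ps, a, ⟨-, -, haX, rfl⟩, -, ha⟩ := hq
      exact hs.mem_of_reflTransGen haX ha
  obtain ⟨s, K, hV, hrun, hKl, hKq, hpos, hK⟩ :=
    hs.exists_shape hgsm h l (hlin l r h) (subAt_nil l) hq
  refine ⟨hqX, s, hV, ?_, hrun⟩
  rintro x ⟨γ, hγ⟩
  rcases hK with hl | hK | hall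
  · exact absurd hl (hgsm.1 _ _ h)
  · rcases hpos γ x hγ with hA | ⟨hγK, hγq⟩
    · exact hA
    -- The variables still visible in `q` are settled by an overlap of the whole of `l` with a
    -- subterm of a right-hand side.
    rcases hs.mem_cases q hqX with hqA | ⟨l₁, r₁, p, e, h₁, ⟨α, hα⟩, he, hqe⟩
    · exact hs.sub_mem q hqA _ ⟨γ, hγq⟩
    · exact hs.overlap_value_mem hgsm h₁ h hα (subAt_nil l) (Or.inr rfl) (hgsm.1 _ _ h) hK hKl hKq
        hqe he hγK hγ hγq
  · exact hall x ⟨γ, hγ⟩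

/-- All instances of subterms of `r` with values in `A` are states, so symbol rules alone rebuild
`p.subst s`. -/
theorem run_rhs (hs : IsSaturated R Sg A X Λ) {l r : Term ar} (h : (l, r) ∈ R.rules)
    {V : ℕ → Term ar → Prop} {s : ℕ → Term ar} (hV : ∀ x ∈ r.vars, V x (s x))
    (hA : ∀ x ∈ r.vars, s x ∈ A) (p : Term ar) (hp : p ∈ r.sub) :
    run (termRules Sg X) Λ V p (p.subst s) := by
  induction p with
  | var x => exact hV x hp
  | app f ps ih =>
    have hX : ∀ p ∈ r.sub, p.subst s ∈ X := fun p hp =>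
      hs.inst_mem l r p s h hp fun x hx => hA x (vars_subset_of_mem_sub hp hx)
    refine ⟨fun i => (ps i).subst s, _, ⟨hs.sign_subset ⟨l, r, h, Or.inr ⟨ps, hp⟩⟩, fun i => ?_,
      hX _ hp, rfl⟩, fun i => ih i (sub_trans (arg_mem_sub f ps i) hp), ReflTransGen.refl⟩
    exact hX _ (sub_trans (arg_mem_sub f ps i) hp)

theorem run_of_step (hs : IsSaturated R Sg A X Λ) (hlin : R.LeftLinear) (hgsm : R.IsGSM)
    {V : ℕ → Term ar → Prop} (hV : ∀ x a b, V x a → Λ a b → V x b) {t t' : Term ar}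
    (h : Step R.rules t t') {q : Term ar} (hq : run (termRules Sg X) Λ V t q) :
    run (termRules Sg X) Λ V t' q := by
  induction h generalizing q with
  | root l r θ hlr =>
    rw [run_subst] at hq
    obtain ⟨hqX, s, hsV, hsA, hrun⟩ := hs.exists_values hlin hgsm hlr hq
    have hvar := R.vars_subset _ _ hlr
    have h1 : run (termRules Sg X) Λ V (r.subst θ) (r.subst s) :=
      run_subst.2 (hs.run_rhs hlr (fun x hx => hsV x (hvar hx)) (fun x hx => hsA x (hvar hx)) r
        (self_mem_sub r))
    -- The run selected states without further changes at the variables; `closed` allows changes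
    -- there, so the reflexive case suffices.
    refine run_trans hV h1 (hs.closed l r s q hlr hsA hqX (run_mono hrun fun x _ q hq => ?_))
    rw [hq]
  | arg f ts i s h ih =>
    obtain ⟨as, a, hΔ, has, ha⟩ := hq
    refine ⟨as, a, hΔ, fun j => ?_, ha⟩
    by_cases hij : j = i
    · subst hij
      rw [Function.update_self]
      exact ih (has j)
    · rw [Function.update_of_ne hij]
      exact has j

theorem run_self (t : Term ar) (ht : t ∈ groundTerms ar Sg) (hX : t.sub ⊆ X)
    {V : ℕ → Term ar → Prop} : run (termRules Sg X) Λ V t t := by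
  induction t with
  | var x => exact absurd ht.1 (not_isGround_var x)
  | app f ts ih =>
    refine ⟨ts, _, ⟨ht.2 (mem_symbols_app.2 (Or.inl rfl)), fun i => hX (arg_mem_sub f ts i),
      hX (self_mem_sub _), rfl⟩, fun i => ih i ⟨isGround_app.1 ht.1 i, ?_⟩ ?_, ReflTransGen.refl⟩
    · exact (symbols_subset_of_mem_sub (arg_mem_sub f ts i)).trans ht.2
    · exact fun s hs => hX (sub_trans hs (arg_mem_sub f ts i))

/-- A saturated automaton evaluates a ground term `t` to the state `p` if and only if `t` is a
descendant of `p`. -/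
theorem run_iff_reduces (hs : IsSaturated R Sg A X Λ) (hlin : R.LeftLinear) (hgsm : R.IsGSM)
    {p t : Term ar} (hp : p ∈ groundTerms ar Sg) (hX : p.sub ⊆ X) (ht : t.IsGround) :
    run (termRules Sg X) Λ (fun _ _ => False) t p ↔ Reduces R.rules p t := by
  constructor
  · intro h
    have := reduces_of_run (θ := var) hs.sound (fun _ _ h => h.elim) h
    rwa [ht.subst_eq] at this
  · intro h
    clear ht
    induction h with
    | refl => exact run_self p hp hX
    | tail _ h2 ih => exact hs.run_of_step hlin hgsm (fun _ _ _ h _ => h) h2 ih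

end IsSaturated

/-! ### Rewriting inside the ground terms over the alphabet. -/

theorem Step.mem_groundTerms {F : Type} {ar : F → ℕ} {R : TRS ar} {Sg : Set F}
    (hSg : R.sign ⊆ Sg) {s t : Term ar} (h : Step R.rules s t) (hs : s ∈ groundTerms ar Sg) :
    t ∈ groundTerms ar Sg := by
  induction h with
  | root l r σ hlr =>
    have hσ : ∀ x ∈ r.vars, σ x ∈ (l.subst σ).sub := fun x hx =>
      Term.subst_mem_sub_subst (R.vars_subset _ _ hlr hx) σ
    refine ⟨Set.eq_empty_of_forall_notMem fun z hz => ?_,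
      Term.symbols_subst_subset (fun f hf => hSg ⟨l, r, hlr, Or.inr hf⟩) fun x hx =>
        (Term.symbols_subset_of_mem_sub (hσ x hx)).trans hs.2⟩
    obtain ⟨x, hx, hzx⟩ := Term.mem_vars_subst.1 hz
    rw [hs.1.of_mem_sub (hσ x hx)] at hzx
    exact hzx
  | arg f ts i s h ih =>
    have hts : ∀ i, ts i ∈ groundTerms ar Sg := fun i => ⟨Term.isGround_app.1 hs.1 i,
      (Term.symbols_subset_of_mem_sub (Term.arg_mem_sub f ts i)).trans hs.2⟩
    have hupd : ∀ j, Function.update ts i s j ∈ groundTerms ar Sg := by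
      intro j
      by_cases hij : j = i
      · subst hij
        rw [Function.update_self]
        exact ih (hts j)
      · rw [Function.update_of_ne hij]
        exact hts j
    refine ⟨Term.isGround_app.2 fun j => (hupd j).1, fun g hg => ?_⟩
    rcases Term.mem_symbols_app.1 hg with rfl | ⟨j, hj⟩
    · exact hs.2 (Term.mem_symbols_app.2 (Or.inl rfl))
    · exact (hupd j).2 hj

theorem Reduces.mem_groundTerms {F : Type} {ar : F → ℕ} {R : TRS ar} {Sg : Set F}
    (hSg : R.sign ⊆ Sg) {s t : Term ar} (h : Reduces R.rules s t) (hs : s ∈ groundTerms ar Sg) :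
    t ∈ groundTerms ar Sg := by
  induction h with
  | refl => exact hs
  | tail _ h2 ih => exact h2.mem_groundTerms hSg ih

/-! ## The saturation procedure -/

namespace TRS

open Term Relation

variable {F : Type} {ar : F → ℕ}

theorem stateTerm_injective {Q : Type} : Function.Injective (stateTerm ar (Q := Q)) := by
  intro a b h
  have := (Term.app.inj h).1
  exact Sum.inr.inj this

theorem lambdaRule_inj {Q : Type} {a b a' b' : Q} (h : lambdaRule ar a b = lambdaRule ar a' b') :
    a = a' ∧ b = b' :=
  ⟨stateTerm_injective (congrArg Prod.fst h), stateTerm_injective (congrArg Prod.snd h)⟩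

theorem lambdaRule_ne_symbolRule {Q : Type} {a b c : Q} {f : F} {as : Fin (ar f) → Q} :
    lambdaRule ar a b ≠ symbolRule ar f as c := by
  intro h
  have := (Term.app.inj (congrArg Prod.fst h)).1
  cases this

/-- A subterm of `p.subst e` is an instance of a subterm of `p` or lies inside a value of `e`; thus
subterms of `D` need no further case. -/
theorem mem_states_cases (R : TRS ar) (L : Set (Term ar)) {q : Term ar}
    (hq : q ∈ subLang (R.setD L)) : q ∈ subLang (L ∪ R.setE) ∨
      ∃ (l r p : Term ar) (e : ℕ → Term ar), (l, r) ∈ R.rules ∧ p ∈ r.sub ∧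
        (∀ x ∈ p.vars, e x ∈ subLang (L ∪ R.setE)) ∧ q = p.subst e := by
  obtain ⟨t, ht, hqt⟩ := Set.mem_iUnion₂.1 hq
  rcases ht with ht | ⟨l, r, p, e, hlr, hp, he, rfl⟩
  · exact Or.inl (subLang_mono Set.subset_union_left (subLang_sub ht hqt))
  · rcases mem_sub_subst hqt with ⟨p', hp', rfl⟩ | ⟨x, hx, hqx⟩
    · exact Or.inr ⟨l, r, p', e, hlr, sub_trans hp' hp,
        fun x hx => he x (vars_subset_of_mem_sub hp' hx), rfl⟩
    · exact Or.inl (subLang_sub (he x hx) hqx)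

theorem inst_mem_states (R : TRS ar) (L : Set (Term ar)) {l r p : Term ar} {e : ℕ → Term ar}
    (hlr : (l, r) ∈ R.rules) (hp : p ∈ r.sub) (he : ∀ x ∈ p.vars, e x ∈ subLang (L ∪ R.setE)) :
    p.subst e ∈ subLang (R.setD L) :=
  subset_subLang _ (Or.inr ⟨l, r, p, e, hlr, hp, he, rfl⟩)

theorem mem_satRules_cases (R : TRS ar) (Sg : Set F) (L : Set (Term ar)) {i : ℕ}
    {ρ : Term (stateRank ar (Term ar)) × Term (stateRank ar (Term ar))}
    (hρ : ρ ∈ R.satRules Sg L i) : ρ ∈ R.satRules Sg L 0 ∨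
      ∃ j < i, ∃ (l r : Term ar) (e : ℕ → Term ar) (c : Term ar), (l, r) ∈ R.rules ∧
        (∀ x ∈ l.vars, e x ∈ subLang (L ∪ R.setE)) ∧ c ∈ subLang (R.setD L) ∧
        Reduces (R.satRules Sg L j)
          ((l.lift (Term ar)).subst fun x => stateTerm ar (e x)) (stateTerm ar c) ∧
        ρ = lambdaRule ar (r.subst e) c := by
  induction i with
  | zero => exact Or.inl hρ
  | succ i ih =>
    rcases hρ with hρ | hρ
    · rcases ih hρ with h | ⟨j, hj, h⟩
      · exact Or.inl h
      · exact Or.inr ⟨j, hj.trans (Nat.lt_succ_self i), h⟩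
    · exact Or.inr ⟨i, Nat.lt_succ_self i, hρ⟩

theorem satRules_mono (R : TRS ar) (Sg : Set F) (L : Set (Term ar)) :
    Monotone (R.satRules Sg L) :=
  monotone_nat_of_le_succ fun _ => Set.subset_union_left

theorem rulesOf_satRules (R : TRS ar) (Sg : Set F) (L : Set (Term ar)) (i : ℕ) :
    RulesOf (R.satRules Sg L i) (termRules Sg (subLang (R.setD L)))
      fun a b => lambdaRule ar a b ∈ R.satRules Sg L i := by
  intro ρ
  constructor
  · intro hρ
    rcases R.mem_satRules_cases Sg L hρ with ⟨f, hf, ps, hps, hX, rfl⟩ |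
      ⟨j, hj, l, r, e, c, -, -, -, -, rfl⟩
    · exact Or.inl ⟨f, ps, _, ⟨hf, hps, hX, rfl⟩, rfl⟩
    · exact Or.inr ⟨_, _, hρ, rfl⟩
  · rintro (⟨f, ps, _, ⟨hf, hps, hX, rfl⟩, rfl⟩ | ⟨a, b, h, rfl⟩)
    · exact R.satRules_mono Sg L (Nat.zero_le i) ⟨f, hf, ps, hps, hX, rfl⟩
    · exact h

theorem lambda_cases (R : TRS ar) (Sg : Set F) (L : Set (Term ar)) {i : ℕ} {a b : Term ar}
    (h : lambdaRule ar a b ∈ R.satRules Sg L i) :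
    ∃ j < i, ∃ (l r : Term ar) (e : ℕ → Term ar), (l, r) ∈ R.rules ∧
      (∀ x ∈ l.vars, e x ∈ subLang (L ∪ R.setE)) ∧ b ∈ subLang (R.setD L) ∧
      run (termRules Sg (subLang (R.setD L))) (fun a b => lambdaRule ar a b ∈ R.satRules Sg L j)
        (fun x => ReflTransGen (fun a b => lambdaRule ar a b ∈ R.satRules Sg L j) (e x)) l b ∧
      a = r.subst e := by
  rcases R.mem_satRules_cases Sg L h with ⟨f, hf, ps, hps, hX, hρ⟩ |
      ⟨j, hj, l, r, e, c, hlr, he, hc, hred, hρ⟩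
  · exact absurd hρ lambdaRule_ne_symbolRule
  · obtain ⟨rfl, rfl⟩ := lambdaRule_inj hρ
    exact ⟨j, hj, l, r, e, hlr, he, hc,
      (reduces_subst_iff_run (R.rulesOf_satRules Sg L j)).1 hred, rfl⟩

/-- A rule `r.subst e → c` comes from an evaluation of `l.subst e` to `c` at an earlier stage, whose
state changes are sound by induction. So `c` reduces to `l.subst e` and then to `r.subst e`. -/
theorem lambda_sound (R : TRS ar) (Sg : Set F) (L : Set (Term ar)) (i : ℕ) (a b : Term ar)
    (h : lambdaRule ar a b ∈ R.satRules Sg L i) : Reduces R.rules b a := by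
  induction i using Nat.strong_induction_on generalizing a b with
  | _ i ih =>
    obtain ⟨j, hj, l, r, e, hlr, -, -, hrun, rfl⟩ := R.lambda_cases Sg L h
    exact (reduces_of_run (ih j hj)
      (fun x q hq => reduces_of_reflTransGen (ih j hj) hq) hrun).tail (Step.root l r e hlr)

theorem isSaturated (R : TRS ar) {Sg : Set F} (hSg : R.sign ⊆ Sg) (L : Set (Term ar)) {i : ℕ}
    (hi : R.satRules Sg L i = R.satRules Sg L (i + 1)) :
    IsSaturated R Sg (subLang (L ∪ R.setE)) (subLang (R.setD L))
      fun a b => lambdaRule ar a b ∈ R.satRules Sg L i where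
  sign_subset := hSg
  sub_mem _ ht _ hs := subLang_sub ht hs
  setE_subset := Set.subset_union_right.trans (subset_subLang _)
  inst_mem _ _ _ _ hlr hp he := R.inst_mem_states L hlr hp he
  mem_cases _ hq := R.mem_states_cases L hq
  source a b h := by
    obtain ⟨j, hj, l, r, e, hlr, he, -, -, rfl⟩ := R.lambda_cases Sg L h
    exact Or.inr ⟨l, r, e, hlr, he, rfl⟩
  target a b h := by
    obtain ⟨j, hj, l, r, e, hlr, he, hb, -⟩ := R.lambda_cases Sg L h
    exact hb
  sound := R.lambda_sound Sg L i
  closed l r e c hlr he hc h := by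
    refine ReflTransGen.single ?_
    rw [hi]
    exact Or.inr ⟨l, r, e, c, hlr, he, hc,
      (reduces_subst_iff_run (R.rulesOf_satRules Sg L i)).2 h, rfl⟩

theorem satAutomaton_language (R : TRS ar) (hlin : R.LeftLinear) (hgsm : R.IsGSM) {Sg : Set F}
    (hSg : R.sign ⊆ Sg) {L : Set (Term ar)} (hL : L ⊆ groundTerms ar Sg) {i : ℕ}
    (hi : R.satRules Sg L i = R.satRules Sg L (i + 1)) :
    (R.satAutomaton Sg L i).language Sg = R.descendants L := by
  have hs := R.isSaturated hSg L hi
  have hX : ∀ p ∈ L, p.sub ⊆ subLang (R.setD L) := fun p hp s hsp =>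
    subset_subLang _ (Or.inl (subLang_sub (subset_subLang _ hp) hsp))
  ext t
  constructor
  · rintro ⟨ht, p, hp, h⟩
    exact ⟨p, hp, (hs.run_iff_reduces hlin hgsm (hL hp) (hX p hp) ht.1).1
      ((reduces_iff_run (R.rulesOf_satRules Sg L i)).1 h)⟩
  · rintro ⟨p, hp, h⟩
    have ht := h.mem_groundTerms hSg (hL hp)
    exact ⟨ht, p, hp, (reduces_iff_run (R.rulesOf_satRules Sg L i)).2
      ((hs.run_iff_reduces hlin hgsm (hL hp) (hX p hp) ht.1).2 h)⟩

theorem exists_finite_satRules_subset (R : TRS ar) {Sg : Set F} (hSg : Sg.Finite)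
    {L : Set (Term ar)} (hL : L.Finite) :
    ∃ B : Set (Term (stateRank ar (Term ar)) × Term (stateRank ar (Term ar))), B.Finite ∧
      ∀ i, R.satRules Sg L i ⊆ B := by
  have hX : (subLang (R.setD L)).Finite := finite_subLang (R.finite_setD hL)
  refine ⟨(⋃ f ∈ Sg, (fun ps => symbolRule ar f ps (app f ps)) ''
      {ps | ∀ i, ps i ∈ subLang (R.setD L)}) ∪
    (fun ab : Term ar × Term ar => lambdaRule ar ab.1 ab.2) ''
      (subLang (R.setD L) ×ˢ subLang (R.setD L)),
    (hSg.biUnion fun f _ => (Set.Finite.pi' fun _ => hX).image _).union ((hX.prod hX).image _),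
    fun i ρ hρ => ?_⟩
  rcases R.mem_satRules_cases Sg L hρ with ⟨f, hf, ps, hps, -, rfl⟩ |
    ⟨j, hj, l, r, e, c, hlr, he, hc, -, rfl⟩
  · exact Or.inl (Set.mem_biUnion hf ⟨ps, hps, rfl⟩)
  · exact Or.inr ⟨(r.subst e, c), ⟨R.inst_mem_states L hlr (self_mem_sub r)
      fun x hx => he x (R.vars_subset _ _ hlr hx), hc⟩, rfl⟩

/-- Otherwise the stages would form an infinite strictly increasing chain of subsets of a finite
set. -/
theorem exists_satRules_eq (R : TRS ar) {Sg : Set F} (hSg : Sg.Finite) {L : Set (Term ar)}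
    (hL : L.Finite) : ∃ i, R.satRules Sg L i = R.satRules Sg L (i + 1) := by
  obtain ⟨B, hB, hsub⟩ := R.exists_finite_satRules_subset hSg hL
  by_contra! hne
  have hmono : StrictMono (R.satRules Sg L) := strictMono_nat_of_lt_succ fun i =>
    lt_of_le_of_ne (R.satRules_mono Sg L (Nat.le_succ i)) (hne i)
  exact Set.infinite_of_injective_forall_mem hmono.injective (s := 𝒫 B) hsub hB.powerset

theorem satAutomaton_isBTA (R : TRS ar) {Sg : Set F} (hSg : Sg.Finite) {L : Set (Term ar)}
    (hL : L.Finite) (i : ℕ) : (R.satAutomaton Sg L i).IsBTA Sg := by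
  obtain ⟨B, hB, hsub⟩ := R.exists_finite_satRules_subset hSg hL
  refine ⟨finite_subLang (R.finite_setD hL), hB.subset (hsub i), fun p hp =>
    subset_subLang _ (Or.inl (subset_subLang _ hp)), fun ρ hρ => ?_⟩
  rcases R.mem_satRules_cases Sg L hρ with ⟨f, hf, ps, hps, hX, rfl⟩ |
    ⟨j, hj, l, r, e, c, hlr, he, hc, -, rfl⟩
  · exact Or.inl ⟨f, hf, ps, _, hps, hX, rfl⟩
  · exact Or.inr ⟨_, R.inst_mem_states L hlr (self_mem_sub r)
      fun x hx => he x (R.vars_subset _ _ hlr hx), c, hc, rfl⟩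

end TRS

/-! ## Terms as words -/

section Words

open Term

/-- Puts the symbol `δ` in front of its arguments, which are the topmost words of the stack `p.1`.
The list `p.2` collects all the words that are formed in this way. -/
def collect (δ : RSym) (p : List (List RSym) × List (List RSym)) :
    List (List RSym) × List (List RSym) :=
  ((δ :: (p.1.take δ.2).flatten) :: p.1.drop δ.2, (δ :: (p.1.take δ.2).flatten) :: p.2)

/-- Parsing of a word from the right: the words of the terms of which the word consists, and the
words of all the subterms. -/
def parse (w : List RSym) : List (List RSym) × List (List RSym) := w.foldr collect ([], [])

theorem foldr_collect_flatten (p : List (List RSym) × List (List RSym)) (ts : List (Term rank))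
    (h : ∀ t ∈ ts, ∀ p, ∃ c, t.word.foldr collect p = (t.word :: p.1, c) ∧
      ∀ w, w ∈ c ↔ w ∈ p.2 ∨ ∃ s ∈ t.sub, w = s.word) :
    ∃ c, (ts.map word).flatten.foldr collect p = (ts.map word ++ p.1, c) ∧
      ∀ w, w ∈ c ↔ w ∈ p.2 ∨ ∃ t ∈ ts, ∃ s ∈ t.sub, w = s.word := by
  induction ts with
  | nil => exact ⟨p.2, by simp, by simp⟩
  | cons t ts ih =>
    obtain ⟨c, hc, hcw⟩ := ih fun t ht => h t (List.mem_cons_of_mem _ ht)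
    obtain ⟨c', hc', hcw'⟩ := h t List.mem_cons_self (ts.map word ++ p.1, c)
    refine ⟨c', by simp [List.foldr_append, hc, hc'], fun w => ?_⟩
    rw [hcw', hcw]
    simp only [List.mem_cons, exists_eq_or_imp]
    rw [or_assoc, or_comm (a := ∃ t ∈ ts, _)]

theorem word_app (f : RSym) (ts : Fin (rank f) → Term rank) :
    (app f ts).word = f :: ((List.ofFn ts).map word).flatten := by
  simp [word, List.map_ofFn, Function.comp_def]

/-- Read from the right, the word of a term pushes the words of its arguments first; its head symbol
then takes exactly as many words off the stack as its rank says. -/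
theorem foldr_collect_word (t : Term rank) (ht : t.IsGround)
    (p : List (List RSym) × List (List RSym)) :
    ∃ c, t.word.foldr collect p = (t.word :: p.1, c) ∧
      ∀ w, w ∈ c ↔ w ∈ p.2 ∨ ∃ s ∈ t.sub, w = s.word := by
  induction t generalizing p with
  | var x => exact absurd ht (not_isGround_var x)
  | app f ts ih =>
    obtain ⟨c, hc, hcw⟩ := foldr_collect_flatten p (List.ofFn ts) fun t ht' p => by
      obtain ⟨i, rfl⟩ := List.mem_ofFn.1 ht'
      exact ih i (isGround_app.1 ht i) p
    have hlen : ((List.ofFn ts).map word).length = f.2 := by simp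
    refine ⟨(app f ts).word :: c, ?_, fun w => ?_⟩
    · rw [word_app, List.foldr_cons, hc]
      simp only [collect, List.take_left' hlen, List.drop_left' hlen]
    · simp only [List.mem_cons, hcw, mem_sub_app, List.mem_ofFn]
      constructor
      · rintro (rfl | h | ⟨_, ⟨i, rfl⟩, s, hs, rfl⟩)
        · exact Or.inr ⟨_, Or.inl rfl, rfl⟩
        · exact Or.inl h
        · exact Or.inr ⟨s, Or.inr ⟨i, hs⟩, rfl⟩
      · rintro (h | ⟨s, rfl | ⟨i, hi⟩, rfl⟩)
        · exact Or.inr (Or.inl h)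
        · exact Or.inl rfl
        · exact Or.inr (Or.inr ⟨_, ⟨i, rfl⟩, s, hi, rfl⟩)

theorem mem_parse_word {t : Term rank} (ht : t.IsGround) {w : List RSym} :
    w ∈ (parse t.word).2 ↔ ∃ s ∈ t.sub, w = s.word := by
  obtain ⟨c, hc, hcw⟩ := foldr_collect_word t ht ([], [])
  rw [parse, hc, hcw]
  simp

theorem parse_tail_word {f : RSym} {ts : Fin (rank f) → Term rank} (ht : (app f ts).IsGround) :
    (parse (app f ts).word.tail).1 = List.ofFn fun i => (ts i).word := by
  obtain ⟨c, hc, -⟩ := foldr_collect_flatten ([], []) (List.ofFn ts) fun t ht' p => by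
    obtain ⟨i, rfl⟩ := List.mem_ofFn.1 ht'
    exact foldr_collect_word _ (isGround_app.1 ht i) p
  rw [word_app, List.tail_cons, parse, hc, List.append_nil, List.map_ofFn]
  rfl

theorem word_injOn : Set.InjOn (word (ar := rank)) {t | t.IsGround} := by
  intro s hs t ht h
  induction s generalizing t with
  | var x => exact absurd hs (not_isGround_var x)
  | app f ss ih =>
    cases t with
    | var y => exact absurd ht (not_isGround_var y)
    | app g ts =>
      have hp := congrArg (fun w => (parse (List.tail w)).1) h
      simp only [parse_tail_word hs, parse_tail_word ht] at hp
      rw [word_app, word_app] at h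
      obtain rfl := (List.cons.inj h).1
      have := List.ofFn_injective hp
      congr 1
      exact funext fun i => ih i (isGround_app.1 hs i) (isGround_app.1 ht i) (congrFun this i)

/-- The word of the instance of a term, where the words of the values of the variables are given by
a list. -/
def instWord : Term rank → List (List RSym) → List RSym
  | var x, ε => ε.getD x []
  | app f ts, ε => f :: (List.ofFn fun i => instWord (ts i) ε).flatten

theorem word_subst {p : Term rank} {e : ℕ → Term rank} {ε : List (List RSym)}
    (h : ∀ x ∈ p.vars, ε.getD x [] = (e x).word) : (p.subst e).word = instWord p ε := by
  induction p with
  | var x => exact (h x (by simp)).symm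
  | app f ts ih =>
    simp only [subst_app, word, instWord]
    congr 3
    exact funext fun i => ih i fun x hx => h x (mem_vars_app.2 ⟨i, hx⟩)

/-- All lists of length `n` with elements from `A`. -/
def envs {α : Type} (A : List α) : ℕ → List (List α)
  | 0 => [[]]
  | n + 1 => A.flatMap fun a => (envs A n).map (List.cons a)

theorem mem_envs {α : Type} {A : List α} {n : ℕ} {ε : List α} :
    ε ∈ envs A n ↔ ε.length = n ∧ ∀ a ∈ ε, a ∈ A := by
  induction n generalizing ε with
  | zero => simp +contextual [envs]
  | succ n ih =>
    cases ε with
    | nil => simp [envs]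
    | cons a ε =>
      simp only [envs, List.mem_flatMap, List.mem_map, ih, List.cons.injEq, List.length_cons,
        Nat.add_right_cancel_iff, List.forall_mem_cons]
      constructor
      · rintro ⟨b, hb, ε', ⟨hl, hε⟩, rfl, rfl⟩
        exact ⟨hl, hb, hε⟩
      · rintro ⟨hl, hb, hε⟩
        exact ⟨a, hb, ε, ⟨hl, hε⟩, rfl, rfl⟩

/-- Iterated filtering by an inflationary condition reaches a fixed point. -/
theorem iterate_filter_fixed {α : Type} (l : List α) (P : List α → α → Prop)
    [∀ Λ, DecidablePred (P Λ)] (hP : ∀ Λ, ∀ a ∈ Λ, P Λ a) :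
    l.filter (P ((fun Λ => l.filter (P Λ))^[l.length] [])) =
      (fun Λ => l.filter (P Λ))^[l.length] [] := by
  set g : List α → List α := fun Λ => l.filter (P Λ) with hg
  have hsucc : ∀ n, g^[n + 1] [] = g (g^[n] []) := fun n => Function.iterate_succ_apply' g n []
  have hsub : ∀ n, (g^[n] []).Sublist (g^[n + 1] []) := by
    intro n
    cases n with
    | zero => exact List.nil_sublist _
    | succ n =>
      rw [hsucc (n + 1), hsucc n]
      -- Consecutive iterates filter the same list, and everything kept in one round is kept in the
      -- next; monotonicity of `P` in its list is not needed.
      have : g (g^[n] []) = (g (g (g^[n] []))).filter (P (g^[n] [])) := by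
        simp only [hg, List.filter_filter]
        refine List.filter_congr fun a ha => ?_
        by_cases h : P (g^[n] []) a
        · have h2 := hP (l.filter (P (g^[n] []))) a (List.mem_filter.2 ⟨ha, by simpa using h⟩)
          simp only [hg] at h h2
          simp [h, h2]
        · simp only [hg] at h
          simp [h]
      rw [this]
      exact List.filter_sublist.trans (by rw [← this])
  have hle : ∀ n, (g^[n] []).length ≤ l.length := by
    intro n
    cases n with
    | zero => simp
    | succ n => rw [hsucc]; exact List.length_filter_le _ _
  have := Nat.stabilises_of_monotone (f := fun n => (g^[n] []).length) (b := l.length)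
    (n := l.length + 1) (monotone_nat_of_le_succ fun n => (hsub n).length_le) hle
    (fun m hm => by
      have h := (hsub m).eq_of_length hm
      simp only [hsucc (m + 1), ← h, ← hsucc]) (Nat.le_succ _)
  have h := (hsub l.length).eq_of_length this.symm
  rw [hsucc] at h
  exact h.symm

end Words

/-! ## Primitive recursive predicates -/

section PrimrecAux

open Primrec

variable {α β : Type} [Primcodable α] [Primcodable β]

theorem primrecPred_forall_fin {n : ℕ} {P : Fin n → α → Prop} (h : ∀ i, PrimrecPred (P i)) :
    PrimrecPred fun a => ∀ i, P i a := by
  induction n with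
  | zero => exact (Primrec.eq.comp (Primrec.const 0) (Primrec.const 0)).of_eq fun a => by simp
  | succ n ih =>
    exact ((h 0).and (ih fun i => h i.succ)).of_eq fun a =>
      (Fin.forall_fin_succ (P := fun i => P i a)).symm

theorem primrecRel_mem : PrimrecRel fun (a : α) (l : List α) => a ∈ l :=
  (PrimrecRel.exists_mem_list (R := fun a b : α => a = b) Primrec.eq).swap.of_eq
    fun a l => by simp

theorem primrecPred_exists_const {T : Type} (l : List T) {P : T → α → Prop}
    (h : ∀ t, PrimrecPred (P t)) : PrimrecPred fun a => ∃ t ∈ l, P t a := by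
  induction l with
  | nil => exact (Primrec.eq.comp (Primrec.const 0) (Primrec.const 1)).of_eq fun a => by simp
  | cons t l ih => exact ((h t).or ih).of_eq fun a => by simp

theorem primrec_flatMap_const {T : Type} (l : List T) {f : T → α → List β}
    (h : ∀ t, Primrec (f t)) : Primrec fun a => l.flatMap fun t => f t a := by
  induction l with
  | nil => exact Primrec.const []
  | cons t l ih => exact (list_append.comp (h t) ih).of_eq fun a => by simp

theorem primrec_collect : Primrec₂ collect := by
  have hw : Primrec fun z : RSym × (List (List RSym) × List (List RSym)) =>
      z.1 :: (z.2.1.take z.1.2).flatten :=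
    list_cons.comp fst (list_flatten.comp (list_take.comp (snd.comp fst) (fst.comp snd)))
  exact Primrec.pair (list_cons.comp hw (list_drop.comp (snd.comp fst) (fst.comp snd)))
    (list_cons.comp hw (snd.comp snd))

theorem primrec_parse : Primrec parse :=
  list_foldr (h := fun _ z => collect z.1 z.2) Primrec.id (Primrec.const ([], []))
    (primrec_collect.comp (fst.comp snd) (snd.comp snd))

theorem primrec_instWord (p : Term rank) : Primrec (instWord p) := by
  induction p with
  | var x => exact (list_getD []).comp Primrec.id (Primrec.const x)
  | app f ts ih =>
    exact list_cons.comp (Primrec.const f) (list_flatten.comp (list_ofFn ih))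

theorem primrec_envs (n : ℕ) : Primrec fun A : List α => envs A n := by
  induction n with
  | zero => exact Primrec.const [[]]
  | succ n ih =>
    exact list_flatMap Primrec.id (list_map (ih.comp fst)
      (list_cons.comp (snd.comp fst) snd))

end PrimrecAux

/-! ## The algorithm -/

namespace TRS

open Term Relation

/-- The symbols of the alphabet, the words of the states, and the pairs of words that stand for the
state changes. -/
abbrev RunData : Type := List RSym × List (List RSym) × List (List RSym × List RSym)

/-- The left-hand side, where the words of the values of the variables are given by a list,
evaluates to the state with the given word. -/
def check : Term rank → RunData × List (List RSym) × List RSym → Prop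
  | var x, z => (z.2.1.getD x [], z.2.2) ∈ z.1.2.2
  | app f ls, z => f ∈ z.1.1 ∧ ∃ w ∈ z.1.2.1, w.head? = some f ∧ (w, z.2.2) ∈ z.1.2.2 ∧
      ∀ i, check (ls i) (z.1, z.2.1, (parse w.tail).1.getD i [])

noncomputable section

variable (R : TRS rank)

def ruleList : List (Term rank × Term rank) := R.finite.toFinset.toList

theorem mem_ruleList {ρ : Term rank × Term rank} : ρ ∈ R.ruleList ↔ ρ ∈ R.rules := by
  simp [ruleList]

theorem finite_parts : (⋃ ρ ∈ R.rules, ρ.2.sub).Finite :=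
  R.finite.biUnion fun ρ _ => ρ.2.finite_sub

/-- The subterms of the right-hand sides. -/
def partList : List (Term rank) := R.finite_parts.toFinset.toList

theorem mem_partList {p : Term rank} :
    p ∈ R.partList ↔ ∃ l r, (l, r) ∈ R.rules ∧ p ∈ r.sub := by
  simp [partList]

/-- A common bound allows substitutions to be coded by lists of one fixed length. -/
theorem exists_varBound : ∃ N, ∀ l r, (l, r) ∈ R.rules → ∀ x ∈ l.vars, x < N := by
  obtain ⟨N, hN⟩ := (R.finite.biUnion fun ρ _ => ρ.1.finite_vars).bddAbove
  exact ⟨N + 1, fun l r h x hx => Nat.lt_succ_of_le (hN (Set.mem_biUnion h hx))⟩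

def varBound : ℕ := R.exists_varBound.choose

theorem lt_varBound {l r : Term rank} (h : (l, r) ∈ R.rules) {x : ℕ} (hx : x ∈ l.vars) :
    x < R.varBound := R.exists_varBound.choose_spec l r h x hx

/-- A constant. -/
def constTerm : Term rank := app ((0, 0) : RSym) Fin.elim0

/-- The values of the substitutions that the algorithm uses; there is at least one, so that every
partial substitution extends to a total one. -/
def baseSet (L : Set (Term rank)) : Set (Term rank) := subLang ({constTerm} ∪ L ∪ R.setE)

/-- The states of the automaton that the algorithm computes. -/
def stateSet (L : Set (Term rank)) : Set (Term rank) :=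
  R.baseSet L ∪ {t | ∃ (l r p : Term rank) (e : ℕ → Term rank), (l, r) ∈ R.rules ∧ p ∈ r.sub ∧
    (∀ x ∈ p.vars, e x ∈ R.baseSet L) ∧ t = p.subst e}

/-- The words from `E` and the constant do not depend on the input, so their list is a constant of
the algorithm; only `L` has to be parsed. -/
def baseWords (Lw : List (List RSym)) : List (List RSym) :=
  (finite_subLang
      ((Set.finite_singleton constTerm).union R.finite_setE)).toFinset.toList.map word ++
    Lw.flatMap fun w => (parse w).2

def envWords (Lw : List (List RSym)) : List (List (List RSym)) :=
  envs (R.baseWords Lw) R.varBound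

def stateWords (Lw : List (List RSym)) : List (List RSym) :=
  R.baseWords Lw ++ R.partList.flatMap fun p => (R.envWords Lw).map (instWord p)

/-- The condition under which a pair of states becomes a state change. -/
def NewPair (z : List RSym × List (List RSym)) (Λ : List (List RSym × List RSym))
    (ab : List RSym × List RSym) : Prop :=
  ab.1 = ab.2 ∨ ab ∈ Λ ∨ (∃ m ∈ R.stateWords z.2, (ab.1, m) ∈ Λ ∧ (m, ab.2) ∈ Λ) ∨
    ∃ ε ∈ R.envWords z.2, ∃ ρ ∈ R.ruleList, ab.1 = instWord ρ.2 ε ∧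
      check ρ.1 ((z.1, R.stateWords z.2, Λ), ε, ab.2)

def pairWords (Lw : List (List RSym)) : List (List RSym × List RSym) :=
  (R.stateWords Lw).flatMap fun a => (R.stateWords Lw).map fun b => (a, b)

open Classical in
def nextPairs (z : List RSym × List (List RSym)) (Λ : List (List RSym × List RSym)) :
    List (List RSym × List RSym) :=
  (R.pairWords z.2).filter (R.NewPair z Λ)

/-- Each round keeps the old pairs, so as many rounds as there are candidates reach a fixed point.
-/
def finalPairs (z : List RSym × List (List RSym)) : List (List RSym × List RSym) :=
  (R.nextPairs z)^[(R.pairWords z.2).length] []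

open Classical in
/-- The code of the automaton for the descendants of a finite tree language. -/
def algorithm (z : List RSym × List (List RSym)) : AutomatonCode :=
  ((R.stateWords z.2).map Encodable.encode, z.2.map Encodable.encode,
    -- For ground input trees the state words are nonempty, so `headI` is the root symbol. The
    -- filter removes terms such as the auxiliary constant when their root lies outside of the
    -- alphabet.
    ((R.stateWords z.2).filter fun w => w.headI ∈ z.1).map fun w =>
      (w.headI, (parse w.tail).1.map Encodable.encode, Encodable.encode w),
    (R.finalPairs z).map fun ab => (Encodable.encode ab.1, Encodable.encode ab.2))

end

/-! ### Computability -/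

section Computability

open Primrec

theorem primrecPred_check (l : Term rank) : PrimrecPred (check l) := by
  induction l with
  | var x =>
    exact primrecRel_mem.comp (Primrec.pair ((list_getD []).comp (fst.comp snd) (Primrec.const x))
      (snd.comp snd)) (snd.comp (snd.comp fst))
  | app f ls ih =>
    refine (primrecRel_mem.comp (Primrec.const f) (fst.comp fst)).and ?_
    have hrel : PrimrecRel fun (w : List RSym) (z : RunData × List (List RSym) × List RSym) =>
        w.head? = some f ∧ (w, z.2.2) ∈ z.1.2.2 ∧
          ∀ i, check (ls i) (z.1, z.2.1, (parse w.tail).1.getD i []) := by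
      refine (Primrec.eq.comp (list_head?.comp fst) (Primrec.const (some f))).and
        ((primrecRel_mem.comp (Primrec.pair fst (snd.comp (snd.comp snd)))
          (snd.comp (snd.comp (fst.comp snd)))).and (primrecPred_forall_fin fun i => ?_))
      exact (ih i).comp (Primrec.pair (fst.comp snd) (Primrec.pair (fst.comp (snd.comp snd))
        ((list_getD []).comp (fst.comp (primrec_parse.comp (list_tail.comp fst)))
          (Primrec.const (i : ℕ)))))
    exact hrel.exists_mem_list.comp (fst.comp (snd.comp fst)) Primrec.id

variable (R : TRS rank)

theorem primrec_baseWords : Primrec R.baseWords :=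
  list_append.comp (Primrec.const _)
    (list_flatMap Primrec.id (snd.comp (primrec_parse.comp snd)))

theorem primrec_envWords : Primrec R.envWords :=
  (primrec_envs R.varBound).comp R.primrec_baseWords

theorem primrec_stateWords : Primrec R.stateWords :=
  list_append.comp R.primrec_baseWords (primrec_flatMap_const _ fun p =>
    list_map R.primrec_envWords ((primrec_instWord p).comp snd))

theorem primrec_pairWords : Primrec R.pairWords :=
  list_flatMap R.primrec_stateWords
    (list_map (R.primrec_stateWords.comp fst) (Primrec.pair (snd.comp fst) snd))

theorem primrecRel_newPair : PrimrecRel fun (ab : List RSym × List RSym)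
    (y : (List RSym × List (List RSym)) × List (List RSym × List RSym)) =>
      R.NewPair y.1 y.2 ab := by
  have hL : Primrec fun y : (List RSym × List RSym) ×
      ((List RSym × List (List RSym)) × List (List RSym × List RSym)) => y.2.1.2 :=
    snd.comp (fst.comp snd)
  refine (Primrec.eq.comp (fst.comp fst) (snd.comp fst)).or
    ((primrecRel_mem.comp fst (snd.comp snd)).or (PrimrecPred.or ?_ ?_))
  · have hrel : PrimrecRel fun (m : List RSym) (y : (List RSym × List RSym) ×
        ((List RSym × List (List RSym)) × List (List RSym × List RSym))) =>
          (y.1.1, m) ∈ y.2.2 ∧ (m, y.1.2) ∈ y.2.2 :=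
      (primrecRel_mem.comp (Primrec.pair (fst.comp (fst.comp snd)) fst)
        (snd.comp (snd.comp snd))).and
      (primrecRel_mem.comp (Primrec.pair fst (snd.comp (fst.comp snd))) (snd.comp (snd.comp snd)))
    exact hrel.exists_mem_list.comp (R.primrec_stateWords.comp hL) Primrec.id
  · have hrel : PrimrecRel fun (ε : List (List RSym)) (y : (List RSym × List RSym) ×
        ((List RSym × List (List RSym)) × List (List RSym × List RSym))) =>
          ∃ ρ ∈ R.ruleList, y.1.1 = instWord ρ.2 ε ∧
            check ρ.1 ((y.2.1.1, R.stateWords y.2.1.2, y.2.2), ε, y.1.2) := by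
      refine primrecPred_exists_const _ fun ρ => ?_
      refine (Primrec.eq.comp (fst.comp (fst.comp snd)) ((primrec_instWord ρ.2).comp fst)).and
        ((primrecPred_check ρ.1).comp (Primrec.pair
          (Primrec.pair (fst.comp (fst.comp (snd.comp snd)))
          (Primrec.pair (R.primrec_stateWords.comp (hL.comp snd)) (snd.comp (snd.comp snd))))
          (Primrec.pair fst (snd.comp (fst.comp snd)))))
    exact hrel.exists_mem_list.comp (R.primrec_envWords.comp hL) Primrec.id

theorem primrec_finalPairs : Primrec R.finalPairs := by
  classical
  have hnext : Primrec₂ R.nextPairs :=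
    (PrimrecRel.listFilter R.primrecRel_newPair).comp
      (R.primrec_pairWords.comp (snd.comp fst)) Primrec.id |>.of_eq fun y => by
        simp only [nextPairs, id]
  exact nat_iterate (list_length.comp (R.primrec_pairWords.comp snd)) (Primrec.const []) hnext

theorem computable_algorithm : Computable R.algorithm := by
  classical
  refine Primrec.to_comp ?_
  have hrel : PrimrecRel fun (w : List RSym) (z : List RSym × List (List RSym)) => w.headI ∈ z.1 :=
    primrecRel_mem.comp (list_headI.comp fst) (fst.comp snd)
  have hstates : Primrec fun z : List RSym × List (List RSym) => R.stateWords z.2 :=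
    R.primrec_stateWords.comp snd
  refine Primrec.pair (list_map hstates (Primrec.encode.comp snd)) (Primrec.pair
    (list_map snd (Primrec.encode.comp snd)) (Primrec.pair (list_map ?_ ?_)
    (list_map R.primrec_finalPairs (Primrec.pair (Primrec.encode.comp (fst.comp snd))
      (Primrec.encode.comp (snd.comp snd))))))
  · exact ((PrimrecRel.listFilter hrel).comp hstates Primrec.id).of_eq fun z => by
      simp only [id]
  · exact Primrec.pair (list_headI.comp snd) (Primrec.pair
      (list_map (fst.comp (primrec_parse.comp (list_tail.comp snd))) (Primrec.encode.comp snd))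
      (Primrec.encode.comp snd))

end Computability

end TRS

/-! ### Correctness of the algorithm -/

namespace TRS

open Term Relation

variable {R : TRS rank}

theorem isGround_constTerm : constTerm.IsGround := isGround_app.2 fun i => Fin.elim0 i

theorem constTerm_mem_baseSet (L : Set (Term rank)) : constTerm ∈ R.baseSet L :=
  subset_subLang _ (Or.inl (Or.inl rfl))

theorem isGround_of_mem_baseSet {L : Set (Term rank)} (hL : ∀ t ∈ L, t.IsGround) {t : Term rank}
    (ht : t ∈ R.baseSet L) : t.IsGround := by
  obtain ⟨s, hs, hts⟩ := Set.mem_iUnion₂.1 ht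
  refine IsGround.of_mem_sub ?_ hts
  rcases hs with (rfl | hs) | hs
  · exact isGround_constTerm
  · exact hL s hs
  · exact hs.1

theorem isGround_of_mem_stateSet {L : Set (Term rank)} (hL : ∀ t ∈ L, t.IsGround) {t : Term rank}
    (ht : t ∈ R.stateSet L) : t.IsGround := by
  rcases ht with ht | ⟨l, r, p, e, -, -, he, rfl⟩
  · exact isGround_of_mem_baseSet hL ht
  · refine Set.eq_empty_of_forall_notMem fun z hz => ?_
    obtain ⟨x, hx, hzx⟩ := mem_vars_subst.1 hz
    rw [isGround_of_mem_baseSet hL (he x hx)] at hzx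
    exact hzx

theorem sub_mem_stateSet {L : Set (Term rank)} {s t : Term rank} (ht : t ∈ R.stateSet L)
    (hs : s ∈ t.sub) : s ∈ R.stateSet L := by
  rcases ht with ht | ⟨l, r, p, e, hlr, hp, he, rfl⟩
  · exact Or.inl (subLang_sub ht hs)
  · rcases mem_sub_subst hs with ⟨p', hp', rfl⟩ | ⟨x, hx, hsx⟩
    · exact Or.inr ⟨l, r, p', e, hlr, sub_trans hp' hp,
        fun x hx => he x (vars_subset_of_mem_sub hp' hx), rfl⟩
    · exact Or.inl (subLang_sub (he x hx) hsx)

theorem mem_baseWords {L : List (Term rank)} (hL : ∀ t ∈ L, t.IsGround) {w : List RSym} :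
    w ∈ R.baseWords (L.map word) ↔ ∃ t ∈ R.baseSet {t | t ∈ L}, w = t.word := by
  simp only [baseWords, List.mem_append, List.mem_map, Finset.mem_toList, Set.Finite.mem_toFinset,
    List.mem_flatMap, exists_exists_and_eq_and]
  constructor
  · rintro (⟨t, ht, rfl⟩ | ⟨t, ht, hw⟩)
    · exact ⟨t, subLang_mono (Set.union_subset_union_left _ Set.subset_union_left) ht, rfl⟩
    · obtain ⟨s, hs, rfl⟩ := (mem_parse_word (hL t ht)).1 hw
      exact ⟨s, subLang_sub (subset_subLang _ (Or.inl (Or.inr ht))) hs, rfl⟩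
  · rintro ⟨s, hs, rfl⟩
    obtain ⟨t, ht, hst⟩ := Set.mem_iUnion₂.1 hs
    rcases ht with (ht | ht) | ht
    · exact Or.inl ⟨s, Set.mem_iUnion₂.2 ⟨t, Or.inl ht, hst⟩, rfl⟩
    · exact Or.inr ⟨t, ht, (mem_parse_word (hL t ht)).2 ⟨s, hst, rfl⟩⟩
    · exact Or.inl ⟨s, Set.mem_iUnion₂.2 ⟨t, Or.inr ht, hst⟩, rfl⟩

/-- The environment `ε` lists the words of the values of `e` at the variables of `p`, and these
values belong to the base set. -/
def Represents (R : TRS rank) (L : Set (Term rank)) (ε : List (List RSym)) (e : ℕ → Term rank)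
    (p : Term rank) : Prop :=
  ∀ x ∈ p.vars, e x ∈ R.baseSet L ∧ ε.getD x [] = (e x).word

theorem exists_env {L : List (Term rank)} (hL : ∀ t ∈ L, t.IsGround) {p : Term rank}
    {e : ℕ → Term rank} (he : ∀ x ∈ p.vars, e x ∈ R.baseSet {t | t ∈ L})
    (hp : ∀ x ∈ p.vars, x < R.varBound) :
    ∃ ε ∈ R.envWords (L.map word), R.Represents {t | t ∈ L} ε e p := by
  classical
  -- Entries for variables outside of `p` are filled with the auxiliary constant, since every entry
  -- must be a base word.
  refine ⟨(List.range R.varBound).map fun x => (if x ∈ p.vars then e x else constTerm).word,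
    mem_envs.2 ⟨by simp, fun w hw => (mem_baseWords hL).2 ?_⟩, fun x hx => ⟨he x hx, ?_⟩⟩
  · obtain ⟨x, -, rfl⟩ := List.mem_map.1 hw
    refine ⟨_, ?_, rfl⟩
    split_ifs with hx
    · exact he x hx
    · exact constTerm_mem_baseSet _
  · simp [List.getD_eq_getElem?_getD, hp x hx, hx]

theorem exists_subst {L : List (Term rank)} (hL : ∀ t ∈ L, t.IsGround) {ε : List (List RSym)}
    (hε : ε ∈ R.envWords (L.map word)) :
    ∃ e : ℕ → Term rank, ∀ p : Term rank, (∀ x ∈ p.vars, x < R.varBound) →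
      R.Represents {t | t ∈ L} ε e p := by
  obtain ⟨hlen, hmem⟩ := mem_envs.1 hε
  have : ∀ x, ∃ t : Term rank, x < R.varBound →
      t ∈ R.baseSet {t | t ∈ L} ∧ ε.getD x [] = t.word := by
    intro x
    by_cases hx : x < R.varBound
    · have hx' : x < ε.length := hlen ▸ hx
      obtain ⟨t, ht, hw⟩ := (mem_baseWords hL).1 (hmem ε[x] (List.getElem_mem hx'))
      exact ⟨t, fun _ => ⟨ht, by rw [List.getD_eq_getElem _ _ hx', hw]⟩⟩
    · exact ⟨constTerm, fun h => absurd h hx⟩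
  choose e he using this
  exact ⟨e, fun p hp x hx => he x (hp x hx)⟩

theorem lt_varBound_of_mem_sub {l r p : Term rank} (h : (l, r) ∈ R.rules) (hp : p ∈ r.sub) :
    ∀ x ∈ p.vars, x < R.varBound := fun _ hx =>
  R.lt_varBound h (R.vars_subset _ _ h (vars_subset_of_mem_sub hp hx))

theorem mem_stateWords {L : List (Term rank)} (hL : ∀ t ∈ L, t.IsGround) {w : List RSym} :
    w ∈ R.stateWords (L.map word) ↔ ∃ t ∈ R.stateSet {t | t ∈ L}, w = t.word := by
  simp only [stateWords, List.mem_append, mem_baseWords hL, List.mem_flatMap, List.mem_map,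
    mem_partList]
  constructor
  · rintro (⟨t, ht, rfl⟩ | ⟨p, ⟨l, r, hlr, hp⟩, ε, hε, rfl⟩)
    · exact ⟨t, Or.inl ht, rfl⟩
    · obtain ⟨e, he⟩ := exists_subst hL hε
      have hrep := he p (lt_varBound_of_mem_sub hlr hp)
      exact ⟨p.subst e, Or.inr ⟨l, r, p, e, hlr, hp, fun x hx => (hrep x hx).1, rfl⟩,
        (word_subst fun x hx => (hrep x hx).2).symm⟩
  · rintro ⟨t, ht | ⟨l, r, p, e, hlr, hp, he, rfl⟩, rfl⟩
    · exact Or.inl ⟨t, ht, rfl⟩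
    · obtain ⟨ε, hε, hrep⟩ := exists_env hL he (lt_varBound_of_mem_sub hlr hp)
      exact Or.inr ⟨p, ⟨l, r, hlr, hp⟩, ε, hε, (word_subst fun x hx => (hrep x hx).2).symm⟩

/-- The state changes given by a list of pairs of words. -/
def pairRel (R : TRS rank) (L : Set (Term rank)) (Λ : List (List RSym × List RSym))
    (a b : Term rank) : Prop :=
  a ∈ R.stateSet L ∧ b ∈ R.stateSet L ∧ (a.word, b.word) ∈ Λ

theorem word_inj_of_mem_stateSet {L : Set (Term rank)} (hL : ∀ t ∈ L, t.IsGround) {s t : Term rank}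
    (hs : s ∈ R.stateSet L) (ht : t ∈ R.stateSet L) (h : s.word = t.word) : s = t :=
  word_injOn (isGround_of_mem_stateSet hL hs) (isGround_of_mem_stateSet hL ht) h

theorem getD_parse_tail_word {f : RSym} {ts : Fin (rank f) → Term rank}
    (ht : (app f ts).IsGround) (i : Fin (rank f)) :
    (parse (app f ts).word.tail).1.getD i [] = (ts i).word := by
  rw [parse_tail_word ht, List.getD_eq_getElem _ _ (by simp)]
  simp

theorem head?_word (f : RSym) (ts : Fin (rank f) → Term rank) :
    (app f ts).word.head? = some f := rfl

theorem run_of_check {Sg : List RSym} {L : List (Term rank)} (hL : ∀ t ∈ L, t.IsGround)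
    {Λ : List (List RSym × List RSym)} {ε : List (List RSym)} {e : ℕ → Term rank} {l q : Term rank}
    (he : R.Represents {t | t ∈ L} ε e l) (hq : q ∈ R.stateSet {t | t ∈ L})
    (h : check l ((Sg, R.stateWords (L.map word), Λ), ε, q.word)) :
    run (termRules {δ | δ ∈ Sg} (R.stateSet {t | t ∈ L})) (R.pairRel {t | t ∈ L} Λ)
      (fun x => ReflTransGen (R.pairRel {t | t ∈ L} Λ) (e x)) l q := by
  induction l generalizing q with
  | var x =>
    obtain ⟨hex, hw⟩ := he x (by simp)
    refine ReflTransGen.single ⟨Or.inl hex, hq, ?_⟩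
    rw [← hw]
    exact h
  | app f ls ih =>
    obtain ⟨hf, w, hw, hhead, hΛ, hi⟩ := h
    obtain ⟨t, ht, rfl⟩ := (mem_stateWords hL).1 hw
    have hg := isGround_of_mem_stateSet hL ht
    cases t with
    | var x => exact absurd hg (not_isGround_var x)
    | app g ts =>
      obtain rfl : g = f := by simpa [head?_word] using hhead
      have hts : ∀ i, ts i ∈ R.stateSet {t | t ∈ L} := fun i =>
        sub_mem_stateSet ht (arg_mem_sub g ts i)
      refine ⟨ts, _, ⟨hf, hts, ht, rfl⟩, fun i => ih i (fun x hx =>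
        he x (mem_vars_app.2 ⟨i, hx⟩)) (hts i) ?_, ReflTransGen.single ⟨ht, hq, hΛ⟩⟩
      have := hi i
      rwa [getD_parse_tail_word hg] at this

/-- `check` tests single pairs instead of paths of state changes, which is why `hΛ` asks for a list
that is closed under reflexivity and transitivity. -/
theorem check_of_run {Sg : List RSym} {L : List (Term rank)} (hL : ∀ t ∈ L, t.IsGround)
    {Λ : List (List RSym × List RSym)} {ε : List (List RSym)} {e : ℕ → Term rank} {l q : Term rank}
    (hΛ : ∀ a b, a ∈ R.stateSet {t | t ∈ L} → ReflTransGen (R.pairRel {t | t ∈ L} Λ) a b →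
      (a.word, b.word) ∈ Λ)
    (he : R.Represents {t | t ∈ L} ε e l)
    (h : run (termRules {δ | δ ∈ Sg} (R.stateSet {t | t ∈ L})) (R.pairRel {t | t ∈ L} Λ)
      (fun x => ReflTransGen (R.pairRel {t | t ∈ L} Λ) (e x)) l q) :
    check l ((Sg, R.stateWords (L.map word), Λ), ε, q.word) := by
  induction l generalizing q with
  | var x =>
    obtain ⟨hex, hw⟩ := he x (by simp)
    have := hΛ _ _ (Or.inl hex) h
    rwa [← hw] at this
  | app f ls ih =>
    obtain ⟨ts, _, ⟨hf, hts, ht, rfl⟩, hrun, hq⟩ := h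
    refine ⟨hf, _, (mem_stateWords hL).2 ⟨_, ht, rfl⟩, head?_word f ts, hΛ _ _ ht hq, fun i => ?_⟩
    rw [getD_parse_tail_word (isGround_of_mem_stateSet hL ht)]
    exact ih i (fun x hx => he x (mem_vars_app.2 ⟨i, hx⟩)) (hrun i)

theorem mem_pairWords {L : List (Term rank)} (hL : ∀ t ∈ L, t.IsGround)
    {ab : List RSym × List RSym} : ab ∈ R.pairWords (L.map word) ↔
      ∃ a ∈ R.stateSet {t | t ∈ L}, ∃ b ∈ R.stateSet {t | t ∈ L}, ab = (a.word, b.word) := by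
  simp only [pairWords, List.mem_flatMap, List.mem_map, mem_stateWords hL]
  constructor
  · rintro ⟨_, ⟨a, ha, rfl⟩, _, ⟨b, hb, rfl⟩, rfl⟩
    exact ⟨a, ha, b, hb, rfl⟩
  · rintro ⟨a, ha, b, hb, rfl⟩
    exact ⟨_, ⟨a, ha, rfl⟩, _, ⟨b, hb, rfl⟩, rfl⟩

theorem nextPairs_finalPairs (z : List RSym × List (List RSym)) :
    R.nextPairs z (R.finalPairs z) = R.finalPairs z := by
  classical
  exact iterate_filter_fixed (R.pairWords z.2) (R.NewPair z) fun Λ a ha => Or.inr (Or.inl ha)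

theorem mem_finalPairs_iff (Sg : List RSym) {L : List (Term rank)} (hL : ∀ t ∈ L, t.IsGround)
    {a b : Term rank} (ha : a ∈ R.stateSet {t | t ∈ L}) (hb : b ∈ R.stateSet {t | t ∈ L}) :
    (a.word, b.word) ∈ R.finalPairs (Sg, L.map word) ↔
      R.NewPair (Sg, L.map word) (R.finalPairs (Sg, L.map word)) (a.word, b.word) := by
  conv_lhs => rw [← nextPairs_finalPairs]
  simp only [nextPairs, List.mem_filter, decide_eq_true_eq, and_iff_right_iff_imp]
  exact fun _ => (mem_pairWords hL).2 ⟨a, ha, b, hb, rfl⟩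

/-- Every state change is justified by a reduction, and leads away from an instance of a right-hand
side unless it is trivial. -/
def SoundPairs (R : TRS rank) (L : Set (Term rank)) (Λ : List (List RSym × List RSym)) : Prop :=
  ∀ a b, R.pairRel L Λ a b → Reduces R.rules b a ∧
    (a = b ∨ ∃ (l r : Term rank) (e : ℕ → Term rank), (l, r) ∈ R.rules ∧
      (∀ x ∈ l.vars, e x ∈ R.baseSet L) ∧ a = r.subst e)

/-- A composed pair is sound by composing reductions, a pair from a rule by turning the successful
`check` into a run. Reflexive pairs are the reason for the alternative `a = b`. -/
theorem soundPairs_nextPairs (Sg : List RSym) {L : List (Term rank)} (hL : ∀ t ∈ L, t.IsGround)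
    {Λ : List (List RSym × List RSym)} (hΛ : R.SoundPairs {t | t ∈ L} Λ) :
    R.SoundPairs {t | t ∈ L} (R.nextPairs (Sg, L.map word) Λ) := by
  rintro a b ⟨ha, hb, hab⟩
  simp only [nextPairs, List.mem_filter, decide_eq_true_eq] at hab
  rcases hab.2 with h | h | ⟨w, hw, h1, h2⟩ | ⟨ε, hε, ⟨l, r⟩, hlr, har, hcheck⟩
  · obtain rfl := word_inj_of_mem_stateSet hL ha hb h
    exact ⟨ReflTransGen.refl, Or.inl rfl⟩
  · exact hΛ a b ⟨ha, hb, h⟩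
  · obtain ⟨m, hm, rfl⟩ := (mem_stateWords hL).1 hw
    obtain ⟨hred1, h1⟩ := hΛ a m ⟨ha, hm, h1⟩
    obtain ⟨hred2, h2⟩ := hΛ m b ⟨hm, hb, h2⟩
    refine ⟨hred2.trans hred1, ?_⟩
    rcases h1 with rfl | h1
    · exact h2
    · exact Or.inr h1
  · rw [mem_ruleList] at hlr
    obtain ⟨e, he⟩ := exists_subst hL hε
    have hel := he l fun x hx => R.lt_varBound hlr hx
    have her := he r (lt_varBound_of_mem_sub hlr (self_mem_sub r))
    have hr : r.subst e ∈ R.stateSet {t | t ∈ L} :=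
      Or.inr ⟨l, r, r, e, hlr, self_mem_sub r, fun x hx => (her x hx).1, rfl⟩
    obtain rfl : a = r.subst e := word_inj_of_mem_stateSet hL ha hr
      (har.trans (word_subst fun x hx => (her x hx).2).symm)
    have hsound := fun a b hab => (hΛ a b hab).1
    exact ⟨(reduces_of_run hsound (fun x q hq => reduces_of_reflTransGen hsound hq)
      (run_of_check hL hel hb hcheck)).tail (Step.root l r e hlr),
      Or.inr ⟨l, r, e, hlr, fun x hx => (hel x hx).1, rfl⟩⟩

theorem soundPairs_finalPairs (Sg : List RSym) {L : List (Term rank)} (hL : ∀ t ∈ L, t.IsGround) :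
    R.SoundPairs {t | t ∈ L} (R.finalPairs (Sg, L.map word)) := by
  have : ∀ n, R.SoundPairs {t | t ∈ L} ((R.nextPairs (Sg, L.map word))^[n] []) := by
    intro n
    induction n with
    | zero => exact fun a b h => absurd h.2.2 (by simp)
    | succ n ih =>
      rw [Function.iterate_succ_apply']
      exact soundPairs_nextPairs Sg hL ih
  exact this _

theorem mem_finalPairs_of_reflTransGen (Sg : List RSym) {L : List (Term rank)}
    (hL : ∀ t ∈ L, t.IsGround) {a b : Term rank} (ha : a ∈ R.stateSet {t | t ∈ L})
    (h : ReflTransGen (R.pairRel {t | t ∈ L} (R.finalPairs (Sg, L.map word))) a b) :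
    (a.word, b.word) ∈ R.finalPairs (Sg, L.map word) := by
  induction h with
  | refl => exact (mem_finalPairs_iff Sg hL ha ha).2 (Or.inl rfl)
  | tail _ h2 ih =>
    exact (mem_finalPairs_iff Sg hL ha h2.2.1).2 (Or.inr (Or.inr (Or.inl
      ⟨_, (mem_stateWords hL).2 ⟨_, h2.1, rfl⟩, ih, h2.2.2⟩)))

/-- Brings the computed automaton under the same completeness argument as the saturation procedure;
`closed` holds because the final list is a fixed point of `nextPairs`. -/
theorem isSaturated_algorithm {Sg : List RSym} (hSg : R.sign ⊆ {δ | δ ∈ Sg})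
    {L : List (Term rank)} (hL : ∀ t ∈ L, t.IsGround) :
    IsSaturated R {δ | δ ∈ Sg} (R.baseSet {t | t ∈ L}) (R.stateSet {t | t ∈ L})
      (R.pairRel {t | t ∈ L} (R.finalPairs (Sg, L.map word))) where
  sign_subset := hSg
  sub_mem _ ht _ hs := subLang_sub ht hs
  setE_subset := Set.subset_union_right.trans (subset_subLang _)
  inst_mem l r p e hlr hp he := Or.inr ⟨l, r, p, e, hlr, hp, he, rfl⟩
  mem_cases _ hq := hq
  source a b h := (soundPairs_finalPairs Sg hL a b h).2
  target a b h := h.2.1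
  sound a b h := (soundPairs_finalPairs Sg hL a b h).1
  closed l r e c hlr he hc h := by
    have hr : r.subst e ∈ R.stateSet {t | t ∈ L} := Or.inr ⟨l, r, r, e, hlr, self_mem_sub r,
      fun x hx => he x (R.vars_subset _ _ hlr hx), rfl⟩
    obtain ⟨ε, hε, hrep⟩ := exists_env hL he fun x hx => R.lt_varBound hlr hx
    refine ReflTransGen.single ⟨hr, hc, (mem_finalPairs_iff Sg hL hr hc).2 (Or.inr (Or.inr (Or.inr
      ⟨ε, hε, (l, r), R.mem_ruleList.2 hlr, ?_, ?_⟩)))⟩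
    · exact word_subst fun x hx => (hrep x (R.vars_subset _ _ hlr hx)).2
    · exact check_of_run hL (fun a b ha => mem_finalPairs_of_reflTransGen Sg hL ha) hrep h

end TRS

/-- Passage from terms to their numbers as states. Injectivity on the set `G` of actual states lets
a path of coded state changes be lifted step by step. -/
theorem run_map_iff {F : Type} {ar : F → ℕ} {Q Q' : Type} {φ : Q → Q'} {G : Set Q}
    (hφ : Set.InjOn φ G) {Δ : (f : F) → (Fin (ar f) → Q) → Q → Prop} {Λ : Q → Q → Prop}
    {Δ' : (f : F) → (Fin (ar f) → Q') → Q' → Prop} {Λ' : Q' → Q' → Prop}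
    (hΔG : ∀ f as a, Δ f as a → (∀ i, as i ∈ G) ∧ a ∈ G) (hΛG : ∀ a b, Λ a b → a ∈ G ∧ b ∈ G)
    (hΔ : ∀ f as' a', Δ' f as' a' ↔ ∃ as a, Δ f as a ∧ as' = φ ∘ as ∧ a' = φ a)
    (hΛ : ∀ a' b', Λ' a' b' ↔ ∃ a b, Λ a b ∧ a' = φ a ∧ b' = φ b) {t : Term ar} {q' : Q'} :
    run Δ' Λ' (fun _ _ => False) t q' ↔
      ∃ q ∈ G, q' = φ q ∧ run Δ Λ (fun _ _ => False) t q := by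
  constructor
  · intro h
    induction t generalizing q' with
    | var x => exact h.elim
    | app f ts ih =>
      obtain ⟨as', a', hΔ', hrun, ha'⟩ := h
      obtain ⟨as, a, hΔa, rfl, rfl⟩ := (hΔ _ _ _).1 hΔ'
      obtain ⟨hasG, haG⟩ := hΔG _ _ _ hΔa
      have hlift : ∃ q ∈ G, q' = φ q ∧ Relation.ReflTransGen Λ a q := by
        induction ha' with
        | refl => exact ⟨a, haG, rfl, Relation.ReflTransGen.refl⟩
        | tail _ h2 ih2 =>
          obtain ⟨q, hq, rfl, hred⟩ := ih2
          obtain ⟨b, c, hbc, hqb, rfl⟩ := (hΛ _ _).1 h2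
          obtain ⟨hb, hc⟩ := hΛG b c hbc
          obtain rfl := hφ hq hb hqb
          exact ⟨c, hc, rfl, hred.tail hbc⟩
      obtain ⟨q, hq, rfl, hred⟩ := hlift
      refine ⟨q, hq, rfl, as, a, hΔa, fun i => ?_, hred⟩
      obtain ⟨b, hb, hab, hrunb⟩ := ih i (hrun i)
      rwa [hφ (hasG i) hb hab]
  · rintro ⟨q, -, rfl, h⟩
    induction t generalizing q with
    | var x => exact h.elim
    | app f ts ih =>
      obtain ⟨as, a, hΔa, hrun, ha⟩ := h
      exact ⟨φ ∘ as, φ a, (hΔ _ _ _).2 ⟨as, a, hΔa, rfl, rfl⟩, fun i => ih i (as i) (hrun i),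
        Relation.ReflTransGen.lift φ (fun a b hab => (hΛ _ _).2 ⟨a, b, hab, rfl, rfl⟩) _ _ ha⟩

/-! ### Automata given by codes, and the automaton that the algorithm outputs. -/

namespace AutomatonCode

theorem rulesOf (c : AutomatonCode) :
    RulesOf c.toAutomaton.rules (fun δ as a => (δ, List.ofFn as, a) ∈ c.2.2.1)
      fun a b => (a, b) ∈ c.2.2.2 := fun _ => Iff.rfl

theorem finite_rules (c : AutomatonCode) : c.toAutomaton.rules.Finite := by
  -- Argument lists of a wrong length contribute spurious rules to this image; only a finite
  -- superset is needed.
  refine ((List.finite_toSet c.2.2.1).image (fun y : RSym × List ℕ × ℕ =>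
    symbolRule rank y.1 (fun i => y.2.1.getD i 0) y.2.2)).union
    ((List.finite_toSet c.2.2.2).image fun y : ℕ × ℕ => lambdaRule rank y.1 y.2) |>.subset ?_
  rintro ρ (⟨δ, as, a, h, rfl⟩ | ⟨a, b, h, rfl⟩)
  · refine Or.inl ⟨_, h, ?_⟩
    have : (fun i : Fin (rank δ) => (List.ofFn as).getD i 0) = as := by
      funext i
      rw [List.getD_eq_getElem _ _ (by simp)]
      simp
    exact congrArg (fun as => symbolRule rank δ as a) this
  · exact Or.inr ⟨_, h, rfl⟩

end AutomatonCode

namespace TRS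

open Term Relation

variable {R : TRS rank} {Sg : List RSym} {L : List (Term rank)}

/-- The number of the state that is given by a term. -/
def stateCode (t : Term rank) : ℕ := Encodable.encode t.word

theorem stateCode_injOn (hL : ∀ t ∈ L, t.IsGround) :
    Set.InjOn stateCode (R.stateSet {t | t ∈ L}) := fun _ hs _ ht h =>
  word_inj_of_mem_stateSet hL hs ht (Encodable.encode_injective h)

theorem mem_algorithm_states (hL : ∀ t ∈ L, t.IsGround) {n : ℕ} :
    n ∈ (R.algorithm (Sg, L.map word)).toAutomaton.states ↔
      ∃ t ∈ R.stateSet {t | t ∈ L}, n = stateCode t := by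
  simp only [algorithm, AutomatonCode.toAutomaton, Set.mem_ofPred_eq, List.mem_map,
    mem_stateWords hL]
  constructor
  · rintro ⟨_, ⟨t, ht, rfl⟩, rfl⟩
    exact ⟨t, ht, rfl⟩
  · rintro ⟨t, ht, rfl⟩
    exact ⟨_, ⟨t, ht, rfl⟩, rfl⟩

theorem mem_algorithm_final {n : ℕ} :
    n ∈ (R.algorithm (Sg, L.map word)).toAutomaton.final ↔ ∃ t ∈ L, n = stateCode t := by
  simp only [algorithm, AutomatonCode.toAutomaton, Set.mem_ofPred_eq, List.mem_map,
    exists_exists_and_eq_and]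
  exact exists_congr fun t => and_congr_right fun _ => eq_comm

theorem mem_algorithm_symbolRules (hL : ∀ t ∈ L, t.IsGround) {f : RSym} {as : Fin (rank f) → ℕ}
    {n : ℕ} : (f, List.ofFn as, n) ∈ (R.algorithm (Sg, L.map word)).2.2.1 ↔
      ∃ ts a, termRules {δ | δ ∈ Sg} (R.stateSet {t | t ∈ L}) f ts a ∧ as = stateCode ∘ ts ∧
        n = stateCode a := by
  have hmap : ∀ {f : RSym} (ts : Fin (rank f) → Term rank), (app f ts).IsGround →
      (parse (app f ts).word.tail).1.map Encodable.encode = List.ofFn (stateCode ∘ ts) := by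
    intro f ts hts
    rw [parse_tail_word hts, List.map_ofFn]
    rfl
  simp only [algorithm, List.mem_map, List.mem_filter, decide_eq_true_eq, mem_stateWords hL]
  constructor
  · rintro ⟨_, ⟨⟨t, ht, rfl⟩, hhead⟩, h⟩
    have hg := isGround_of_mem_stateSet hL ht
    cases t with
    | var x => exact absurd hg (not_isGround_var x)
    | app g ts =>
      rw [hmap ts hg] at h
      obtain rfl : g = f := congrArg Prod.fst h
      have h2 := congrArg Prod.snd h
      exact ⟨ts, _, ⟨hhead, fun i => sub_mem_stateSet ht (arg_mem_sub g ts i), ht, rfl⟩,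
        (List.ofFn_injective (congrArg Prod.fst h2)).symm, (congrArg Prod.snd h2).symm⟩
  · rintro ⟨ts, _, ⟨hf, hts, ht, rfl⟩, rfl, rfl⟩
    refine ⟨_, ⟨⟨_, ht, rfl⟩, hf⟩, ?_⟩
    rw [hmap ts (isGround_of_mem_stateSet hL ht)]
    rfl

theorem mem_algorithm_lambdaRules (hL : ∀ t ∈ L, t.IsGround) {m n : ℕ} :
    (m, n) ∈ (R.algorithm (Sg, L.map word)).2.2.2 ↔
      ∃ a b, R.pairRel {t | t ∈ L} (R.finalPairs (Sg, L.map word)) a b ∧ m = stateCode a ∧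
        n = stateCode b := by
  simp only [algorithm, List.mem_map]
  constructor
  · rintro ⟨ab, hab, h⟩
    have hab' := hab
    rw [← nextPairs_finalPairs] at hab'
    obtain ⟨a, ha, b, hb, rfl⟩ := (mem_pairWords hL).1 (List.mem_filter.1 hab').1
    exact ⟨a, b, ⟨ha, hb, hab⟩, (congrArg Prod.fst h).symm, (congrArg Prod.snd h).symm⟩
  · rintro ⟨a, b, ⟨-, -, hab⟩, rfl, rfl⟩
    exact ⟨_, hab, rfl⟩

theorem subset_stateSet {t : Term rank} (ht : t ∈ L) : t.sub ⊆ R.stateSet {t | t ∈ L} :=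
  fun _ hs => Or.inl (subLang_sub (subset_subLang _ (Or.inl (Or.inr ht))) hs)

theorem algorithm_isBTA (hL : ∀ t ∈ L, t.IsGround) :
    (R.algorithm (Sg, L.map word)).toAutomaton.IsBTA {δ | δ ∈ Sg} := by
  refine ⟨List.finite_toSet _, AutomatonCode.finite_rules _, fun n hn => ?_, ?_⟩
  · obtain ⟨t, ht, rfl⟩ := mem_algorithm_final.1 hn
    exact (mem_algorithm_states hL).2 ⟨t, subset_stateSet ht (self_mem_sub t), rfl⟩
  · rintro ρ (⟨f, as, n, h, rfl⟩ | ⟨m, n, h, rfl⟩)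
    · obtain ⟨ts, _, ⟨hf, hts, ht, rfl⟩, rfl, rfl⟩ := (mem_algorithm_symbolRules hL).1 h
      exact Or.inl ⟨f, hf, _, _, fun i => (mem_algorithm_states hL).2 ⟨ts i, hts i, rfl⟩,
        (mem_algorithm_states hL).2 ⟨_, ht, rfl⟩, rfl⟩
    · obtain ⟨a, b, ⟨ha, hb, -⟩, rfl, rfl⟩ := (mem_algorithm_lambdaRules hL).1 h
      exact Or.inr ⟨_, (mem_algorithm_states hL).2 ⟨a, ha, rfl⟩, _,
        (mem_algorithm_states hL).2 ⟨b, hb, rfl⟩, rfl⟩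

theorem algorithm_language (hlin : R.LeftLinear) (hgsm : R.IsGSM) (hSg : R.sign ⊆ {δ | δ ∈ Sg})
    (hL : ∀ t ∈ L, t ∈ groundTerms rank {δ | δ ∈ Sg}) :
    (R.algorithm (Sg, L.map word)).toAutomaton.language {δ | δ ∈ Sg} =
      R.descendants {t | t ∈ L} := by
  have hg : ∀ t ∈ L, t.IsGround := fun t ht => (hL t ht).1
  have hs := isSaturated_algorithm hSg hg
  have hrun : ∀ {t : Term rank} {p : Term rank}, p ∈ L → t.IsGround →
      (Reduces (R.algorithm (Sg, L.map word)).toAutomaton.rules (t.lift ℕ)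
        (stateTerm rank (stateCode p)) ↔ Reduces R.rules p t) := by
    intro t p hp ht
    have hpX := subset_stateSet (R := R) hp
    rw [reduces_iff_run (AutomatonCode.rulesOf _), ← hs.run_iff_reduces hlin hgsm (hL p hp) hpX ht,
      run_map_iff (stateCode_injOn (R := R) hg)
        (fun f as a (h : termRules {δ | δ ∈ Sg} _ f as a) => ⟨h.2.1, h.2.2.2 ▸ h.2.2.1⟩)
        (fun a b h => ⟨h.1, h.2.1⟩) (fun f as a => mem_algorithm_symbolRules hg)
        (fun a b => mem_algorithm_lambdaRules hg)]
    constructor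
    · rintro ⟨q, hq, hpq, h⟩
      rwa [stateCode_injOn hg (hpX (self_mem_sub p)) hq hpq]
    · exact fun h => ⟨p, hpX (self_mem_sub p), rfl, h⟩
  ext t
  constructor
  · rintro ⟨ht, n, hn, h⟩
    obtain ⟨p, hp, rfl⟩ := mem_algorithm_final.1 hn
    exact ⟨p, hp, (hrun hp ht.1).1 h⟩
  · rintro ⟨p, hp, h⟩
    have ht := h.mem_groundTerms hSg (hL p hp)
    exact ⟨ht, _, mem_algorithm_final.2 ⟨p, hp, rfl⟩, (hrun hp ht.1).2 h⟩

theorem isEPRF (hlin : R.LeftLinear) (hgsm : R.IsGSM) : R.IsEPRF :=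
  ⟨R.algorithm, R.computable_algorithm, fun _ _ hSg hL =>
    ⟨algorithm_isBTA fun t ht => (hL t ht).1, algorithm_language hlin hgsm hSg hL⟩⟩

end TRS

theorem mainTheorem1 (R : TRS rank) (hlin : R.LeftLinear) (hgsm : R.IsGSM) :
    R.IsEPRF ∧
    R.setE.Finite ∧
    ∀ (Sg : Set RSym) (L : Set (Term rank)), Sg.Finite → R.sign ⊆ Sg → L.Finite →
      L ⊆ groundTerms rank Sg →
        (R.setD L).Finite ∧
        ∃ M : ℕ, IsLeast {i | R.satRules Sg L i = R.satRules Sg L (i + 1)} M ∧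
          (R.satAutomaton Sg L M).IsBTA Sg ∧
          (R.satAutomaton Sg L M).language Sg = R.descendants L := by
  classical
  refine ⟨TRS.isEPRF hlin hgsm, R.finite_setE, fun Sg L hSg hsign hL hLg =>
    ⟨R.finite_setD hL, ?_⟩⟩
  have hex := R.exists_satRules_eq hSg hL
  exact ⟨Nat.find hex, ⟨Nat.find_spec hex, fun i hi => Nat.find_min' hex hi⟩,
    R.satAutomaton_isBTA hSg hL _,
    R.satAutomaton_language hlin hgsm hsign hLg (Nat.find_spec hex)⟩
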